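/- Let $G=(V,E)$ be a finite simple graph with $n$ vertices and $m$ edges, and let $S$ be a spanning caterpillar of $G$, that is, a spanning tree of $G$ such that removing all vertices of degree one of $S$ (the leaves) results in a (possibly empty) path, the spine. Then $G$ has a straight-line drawing $\Gamma$ in the plane (vertices are distinct points, edges are straight segments that contain no vertices other than their ends) in which no edge of $S$ is crossed: an edge of $S$ and any other edge of $G$ have no point in common except possibly a common end-vertex. Moreover, $\Gamma$ can be chosen such that 1. the spine vertices of $S$ lie on a quarter of a circle, all leaves of $S$ lie strictly inside this circle, and the leaves of each spine vertex lie on a common circular arc; 2. any two vertices have Euclidean distance at least $1$, and the axis-parallel bounding box of $\Gamma$ has area $O(n^2)$; 3. $\Gamma$ is computed in $O(n+m)$ time in the real RAM model with unit-cost arithmetic, square roots and basic trigonometric functions: there is one program that, given $n$ and the lists of the edges of $G$ and of $S$ in arbitrary order, outputs the coordinates of the vertices of such a drawing after at most $C\,(n+m)$ steps. The constants, including $C$, are absolute. -/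

import Mathlib

/-! ## Straight-line drawings -/

/-- The Euclidean plane. -/
abbrev Plane : Type := EuclideanSpace ℝ (Fin 2)

/-- `pos` is a straight-line drawing of `G`: vertices are distinct points, each edge is the closed
segment between its end-vertices, and no edge passes through a vertex other than its ends. -/
structure IsStraightLineDrawing {V : Type*} (G : SimpleGraph V) (pos : V → Plane) : Prop where
  injective : Function.Injective pos
  no_vertex_on_edge : ∀ a b v : V, G.Adj a b → v ≠ a → v ≠ b →
    pos v ∉ segment ℝ (pos a) (pos b)

/-- `pos` is a straight-line compatible drawing of `⟨G, S⟩`: a straight-line drawing of `G` in which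
an edge of `S` meets another edge of `G` at most in a common end-vertex of the two edges. -/
structure IsCompatibleDrawing {V : Type*} (G S : SimpleGraph V) (pos : V → Plane) : Prop where
  drawing : IsStraightLineDrawing G pos
  not_crossed : ∀ a b c d : V, S.Adj a b → G.Adj c d → s(a, b) ≠ s(c, d) →
    ∀ p ∈ segment ℝ (pos a) (pos b), p ∈ segment ℝ (pos c) (pos d) →
      ∃ w : V, w ∈ s(a, b) ∧ w ∈ s(c, d) ∧ p = pos w

/-- The resolution rule: vertices are pairwise at distance at least one. -/
def HasUnitResolution {V : Type*} (pos : V → Plane) : Prop :=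
  ∀ u v : V, u ≠ v → 1 ≤ dist (pos u) (pos v)

/-- The set of all points of the plane that are drawn: all vertices and all edges. -/
def drawnPoints {V : Type*} (G : SimpleGraph V) (pos : V → Plane) : Set Plane :=
  Set.range pos ∪ {p | ∃ a b : V, G.Adj a b ∧ p ∈ segment ℝ (pos a) (pos b)}

/-- The length of the projection of a (nonempty, bounded) set on the `i`-th coordinate axis. -/
noncomputable def extent (X : Set Plane) (i : Fin 2) : ℝ :=
  sSup ((fun p : Plane => p i) '' X) - sInf ((fun p : Plane => p i) '' X)

/-- The area of a drawing: width times height of its smallest axis-parallel enclosing rectangle. -/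
noncomputable def drawingArea {V : Type*} (G : SimpleGraph V) (pos : V → Plane) : ℝ :=
  extent (drawnPoints G pos) 0 * extent (drawnPoints G pos) 1

/-! ## Caterpillars -/

/-- `v` is a leaf of `T`: a vertex of degree one. -/
def IsLeafOf {V : Type*} (T : SimpleGraph V) (v : V) : Prop := ∃! w : V, T.Adj v w

/-- The spine vertices of `T`: those that are not leaves. -/
def spineSet {V : Type*} (T : SimpleGraph V) : Set V := {v | ¬ IsLeafOf T v}

/-- A caterpillar is a tree such that removing all its leaves results in a path. (For the tree with
a single edge, this is the path with `k = 0` vertices.) -/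
def IsCaterpillar {V : Type*} (T : SimpleGraph V) : Prop :=
  T.IsTree ∧ ∃ k : ℕ, Nonempty (T.induce (spineSet T) ≃g SimpleGraph.pathGraph k)

/-- The layout: the spine vertices lie on a quarter of a circle, every leaf lies strictly
inside that circle, and the leaves of each spine vertex lie together on a circular arc. -/
def IsQuarterCircleLayout {V : Type*} (T : SimpleGraph V) (pos : V → Plane) : Prop :=
  ∃ (o : Plane) (r : ℝ), 0 < r ∧
    (∀ u ∈ spineSet T, dist (pos u) o = r ∧ (pos u) 0 ≤ o 0 ∧ o 1 ≤ (pos u) 1) ∧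
    (∀ v : V, IsLeafOf T v → dist (pos v) o < r) ∧
    (∀ u ∈ spineSet T, EuclideanGeometry.Cospherical (pos '' {v | IsLeafOf T v ∧ T.Adj u v}))

/-! ## The real RAM

Programs are `while`-programs over a random access memory. The memory consists of arrays of natural
numbers (used for data such as vertex names and counters, and as addresses) and arrays of real
numbers. A program names only finitely many arrays; scalar variables are array cells with a constant
index. Every operation on exact real numbers takes one step, including `sqrt` and the trigonometric
functions; there is no rounding operation and no conversion from reals to natural numbers, and the
only real constants are natural numbers. The only operations on natural numbers are addition,
truncated subtraction and comparison. -/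

namespace RealRAM

/-- A memory state: `nat a i` and `real a i` are the contents of cell `i` of array `a`. -/
structure State : Type where
  nat : ℕ → ℕ → ℕ
  real : ℕ → ℕ → ℝ

/-- Expressions for natural numbers; `load a i` reads cell `i` of array `a`. -/
inductive NatExpr : Type
  | const (k : ℕ)
  | load (a : ℕ) (i : NatExpr)
  | add (e f : NatExpr)
  | sub (e f : NatExpr)

namespace NatExpr

/-- The value of an expression. -/
def value (s : State) : NatExpr → ℕ
  | const k => k
  | load a i => s.nat a (i.value s)
  | add e f => e.value s + f.value s
  | sub e f => e.value s - f.value s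

/-- The number of steps to evaluate an expression: one for each constant and operation in it. -/
def cost : NatExpr → ℕ
  | const _ => 1
  | load _ i => i.cost + 1
  | add e f => e.cost + f.cost + 1
  | sub e f => e.cost + f.cost + 1

end NatExpr

/-- Expressions for real numbers; `cast e` is a natural number seen as a real number, `load a i`
reads cell `i` of array `a`. -/
inductive RealExpr : Type
  | cast (e : NatExpr)
  | load (a : ℕ) (i : NatExpr)
  | add (x y : RealExpr)
  | sub (x y : RealExpr)
  | mul (x y : RealExpr)
  | div (x y : RealExpr)
  | sqrt (x : RealExpr)
  | sin (x : RealExpr)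
  | cos (x : RealExpr)
  | arctan (x : RealExpr)

namespace RealExpr

/-- The value of an expression. Division by zero and roots of negative numbers give `0`; this adds
no power, since a program can make these case distinctions by a comparison. -/
noncomputable def value (s : State) : RealExpr → ℝ
  | cast e => (e.value s : ℝ)
  | load a i => s.real a (i.value s)
  | add x y => x.value s + y.value s
  | sub x y => x.value s - y.value s
  | mul x y => x.value s * y.value s
  | div x y => x.value s / y.value s
  | sqrt x => Real.sqrt (x.value s)
  | sin x => Real.sin (x.value s)
  | cos x => Real.cos (x.value s)
  | arctan x => Real.arctan (x.value s)

/-- The number of steps to evaluate an expression. -/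
def cost : RealExpr → ℕ
  | cast e => e.cost + 1
  | load _ i => i.cost + 1
  | add x y => x.cost + y.cost + 1
  | sub x y => x.cost + y.cost + 1
  | mul x y => x.cost + y.cost + 1
  | div x y => x.cost + y.cost + 1
  | sqrt x => x.cost + 1
  | sin x => x.cost + 1
  | cos x => x.cost + 1
  | arctan x => x.cost + 1

end RealExpr

/-- Tests. -/
inductive Test : Type
  | natLt (e f : NatExpr)
  | natEq (e f : NatExpr)
  | realLt (x y : RealExpr)
  | not (b : Test)

namespace Test

/-- The test succeeds. -/
def Holds (s : State) : Test → Prop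
  | natLt e f => e.value s < f.value s
  | natEq e f => e.value s = f.value s
  | realLt x y => x.value s < y.value s
  | not b => ¬ b.Holds s

/-- The number of steps to evaluate a test. -/
def cost : Test → ℕ
  | natLt e f => e.cost + f.cost + 1
  | natEq e f => e.cost + f.cost + 1
  | realLt x y => x.cost + y.cost + 1
  | not b => b.cost + 1

end Test

/-- Programs; `setNat a i e` stores the value of `e` in cell `i` of array `a`. -/
inductive Program : Type
  | skip
  | setNat (a : ℕ) (i e : NatExpr)
  | setReal (a : ℕ) (i : NatExpr) (x : RealExpr)
  | seq (p q : Program)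
  | ite (b : Test) (p q : Program)
  | while (b : Test) (p : Program)

/-- The state after storing `k` in cell `i` of the array `a` of natural numbers. -/
def State.storeNat (s : State) (a i k : ℕ) : State :=
  { s with nat := Function.update s.nat a (Function.update (s.nat a) i k) }

/-- The state after storing `x` in cell `i` of the array `a` of real numbers. -/
noncomputable def State.storeReal (s : State) (a i : ℕ) (x : ℝ) : State :=
  { s with real := Function.update s.real a (Function.update (s.real a) i x) }

/-- `Run p s t s'`: program `p`, started in state `s`, halts after exactly `t` steps in
state `s'`. -/
inductive Run : Program → State → ℕ → State → Prop
  | skip (s : State) : Run .skip s 1 s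
  | setNat (s : State) (a : ℕ) (i e : NatExpr) :
      Run (.setNat a i e) s (i.cost + e.cost + 1) (s.storeNat a (i.value s) (e.value s))
  | setReal (s : State) (a : ℕ) (i : NatExpr) (x : RealExpr) :
      Run (.setReal a i x) s (i.cost + x.cost + 1) (s.storeReal a (i.value s) (x.value s))
  | seq {p q : Program} {s s' s'' : State} {t t' : ℕ} :
      Run p s t s' → Run q s' t' s'' → Run (.seq p q) s (t + t') s''
  | ite_true {b : Test} {p q : Program} {s s' : State} {t : ℕ} :
      b.Holds s → Run p s t s' → Run (.ite b p q) s (b.cost + t) s'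
  | ite_false {b : Test} {p q : Program} {s s' : State} {t : ℕ} :
      ¬ b.Holds s → Run q s t s' → Run (.ite b p q) s (b.cost + t) s'
  | while_true {b : Test} {p : Program} {s s' s'' : State} {t t' : ℕ} :
      b.Holds s → Run p s t s' → Run (.while b p) s' t' s'' →
      Run (.while b p) s (b.cost + t + t') s''
  | while_false {b : Test} {p : Program} {s : State} :
      ¬ b.Holds s → Run (.while b p) s b.cost s

end RealRAM

/-! ## Input and output -/

/-- `L` lists every edge of `G` exactly once, in any order and with any order of its two ends. -/
def IsEdgeList {n : ℕ} (G : SimpleGraph (Fin n)) (L : List (Fin n × Fin n)) : Prop :=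
  (L.map fun e => s(e.1, e.2)).Nodup ∧
    ∀ a b : Fin n, s(a, b) ∈ L.map (fun e => s(e.1, e.2)) ↔ G.Adj a b

/-- The initial memory for a graph with vertices `0, …, n - 1`, edge list `L`, and a
subgraph with edge list `W`: array `0` holds `n` and the lengths of both lists, arrays `1` and `2`
hold the first and second ends of the edges in `L`, arrays `3` and `4` those of the edges in `W`;
all other cells are zero. -/
def inputState (n : ℕ) (L W : List (Fin n × Fin n)) : RealRAM.State where
  nat a i :=
    match a with
    | 0 => [n, L.length, W.length].getD i 0
    | 1 => (L.map fun e => (e.1 : ℕ)).getD i 0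
    | 2 => (L.map fun e => (e.2 : ℕ)).getD i 0
    | 3 => (W.map fun e => (e.1 : ℕ)).getD i 0
    | 4 => (W.map fun e => (e.2 : ℕ)).getD i 0
    | _ => 0
  real _ _ := 0

/-- The computed drawing: the coordinates of vertex `v` are in cell `v` of the real arrays `0`
and `1`. -/
noncomputable def outputDrawing (n : ℕ) (s : RealRAM.State) : Fin n → Plane :=
  fun v => !₂[s.real 0 v, s.real 1 v]

/-!
The vertices are placed on rays from the centre of a quarter circle of radius `R`. Every spine
vertex lies on the circle at the beginning of a block of rays, and its leaves are placed on rays in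
the second half of this block, inside the circle and on a common circular arc. An edge of the
caterpillar is not crossed as soon as there is an affine function that vanishes at one of its ends,
is nonnegative at the other one and negative at all other vertices; if it is positive at the other
end, it remains to check the edges at that end. For two consecutive spine vertices, this function
is given by their chord. For a leaf `v` of `u`, it is given by the tangent at `v` of the circle of
the leaves of `u`, that is, by the power of a point with respect to this circle minus its squared
distance from `v`: the circle is chosen such that `u` has power `4 R ^ 2`, more than its squared
distance from any leaf, whereas all other vertices lie inside or on the circle.

The position of a vertex depends only on the order of the spine and on the numbers of leaves. Both
are found in linear time by adding names of vertices: the sum of the neighbours of a leaf on the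
spine is its only neighbour there, and in a walk along the spine the next vertex is the sum of the
neighbours on the spine minus the previous vertex.
-/

/-! ## Uncrossed edges -/

section Separation

variable {E : Type*} [AddCommGroup E] [Module ℝ E] {f : E →ᵃ[ℝ] ℝ} {x y p : E}

theorem apply_nonneg_of_mem_segment (hx : 0 ≤ f x) (hy : 0 ≤ f y) (hp : p ∈ segment ℝ x y) :
    0 ≤ f p :=
  ((convex_Ici (0 : ℝ)).affine_preimage f).segment_subset hx hy hp

theorem apply_neg_of_mem_segment (hx : f x < 0) (hy : f y < 0) (hp : p ∈ segment ℝ x y) :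
    f p < 0 :=
  ((convex_Iio (0 : ℝ)).affine_preimage f).segment_subset hx hy hp

theorem eq_left_of_mem_segment (hx : f x ≤ 0) (hy : f y < 0) (hp : p ∈ segment ℝ x y)
    (hfp : 0 ≤ f p) : p = x := by
  obtain ⟨s, t, hs, ht, hst, rfl⟩ := hp
  rw [Convex.combo_affine_apply hst, smul_eq_mul, smul_eq_mul] at hfp
  obtain rfl : t = 0 := by nlinarith
  obtain rfl : s = 1 := by linarith
  simp

variable {V : Type*}

/-- The segment `ab` is an uncrossed edge of the complete geometric graph on the points `pos v`: it
meets every other segment between two of these points at most in a common end. -/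
def IsUncrossed (pos : V → E) (a b : V) : Prop :=
  ∀ c d : V, c ≠ d → s(a, b) ≠ s(c, d) →
    ∀ p ∈ segment ℝ (pos a) (pos b), p ∈ segment ℝ (pos c) (pos d) →
      ∃ w : V, w ∈ s(a, b) ∧ w ∈ s(c, d) ∧ p = pos w

variable {pos : V → E} {a b u v : V}

theorem IsUncrossed.symm (h : IsUncrossed pos a b) : IsUncrossed pos b a := by
  intro c d hcd hne p hp
  rw [segment_symm] at hp
  rw [Sym2.eq_swap] at hne ⊢
  exact h c d hcd hne p hp

theorem isUncrossed_of_supporting_line (ha : f (pos a) = 0) (hb : f (pos b) = 0)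
    (hneg : ∀ q, q ≠ a → q ≠ b → f (pos q) < 0) : IsUncrossed pos a b := by
  intro c d hcd hne p hp hp'
  have hfp : 0 ≤ f p := apply_nonneg_of_mem_segment ha.ge hb.ge hp
  have hlt : ∀ q ∉ s(a, b), f (pos q) < 0 := fun q hq => by
    rw [Sym2.mem_iff, not_or] at hq
    exact hneg q hq.1 hq.2
  have hle : ∀ q, f (pos q) ≤ 0 := fun q => by
    by_cases hq : q ∈ s(a, b)
    · rcases Sym2.mem_iff.1 hq with rfl | rfl
      exacts [ha.le, hb.le]
    · exact (hlt q hq).le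
  have hend : ∀ c d, d ∉ s(a, b) → p ∈ segment ℝ (pos c) (pos d) → c ∈ s(a, b) ∧ p = pos c := by
    intro c d hd hp
    have hpc : p = pos c := eq_left_of_mem_segment (hle c) (hlt d hd) hp hfp
    refine ⟨?_, hpc⟩
    by_contra hc
    exact (hlt c hc).not_ge (hpc ▸ hfp)
  by_cases hd : d ∈ s(a, b)
  · have hc : c ∉ s(a, b) := fun hc => hne ((Sym2.mem_and_mem_iff hcd).1 ⟨hc, hd⟩)
    obtain ⟨hd, hpd⟩ := hend d c hc (segment_symm ℝ (pos c) (pos d) ▸ hp')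
    exact ⟨d, hd, Sym2.mem_mk_right c d, hpd⟩
  · obtain ⟨hc, hpc⟩ := hend c d hd hp'
    exact ⟨c, hc, Sym2.mem_mk_left c d, hpc⟩

-- If two segments from `u` share a second point, one of them contains the other.
theorem eq_of_mem_segment_of_mem_segment (hx : f x = 0) (hy : 0 < f y) {z : E} (hz : f z < 0)
    (hray : x ∉ segment ℝ y z) (hp : p ∈ segment ℝ x y) (hp' : p ∈ segment ℝ y z) : p = y := by
  by_contra hpy
  rw [segment_symm, mem_segment_iff_wbtw] at hp
  rw [mem_segment_iff_wbtw] at hp' hray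
  have hsame : SameRay ℝ (x -ᵥ y) (z -ᵥ y) :=
    (hp.sameRay_vsub_left.symm).trans hp'.sameRay_vsub_left fun h =>
      absurd (vsub_eq_zero_iff_eq.1 h) hpy
  rcases wbtw_total_of_sameRay_vsub_left hsame with h | h
  · exact hray h
  · exact hz.not_ge (apply_nonneg_of_mem_segment hy.le hx.ge (mem_segment_iff_wbtw.2 h))

theorem isUncrossed_of_separating_line (hv : f (pos v) = 0) (hu : 0 < f (pos u))
    (hneg : ∀ q, q ≠ v → q ≠ u → f (pos q) < 0)
    (hray : ∀ q, q ≠ v → q ≠ u → pos v ∉ segment ℝ (pos u) (pos q)) : IsUncrossed pos v u := by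
  intro c d hcd hne p hp hp'
  have hfp : 0 ≤ f p := apply_nonneg_of_mem_segment hv.ge hu.le hp
  have hfrom_u : ∀ d, d ≠ v → d ≠ u → p ∈ segment ℝ (pos u) (pos d) → p = pos u :=
    fun d hdv hdu => eq_of_mem_segment_of_mem_segment hv hu (hneg d hdv hdu) (hray d hdv hdu) hp
  have hend : ∀ c d, c ≠ u → d ≠ v → d ≠ u → p ∈ segment ℝ (pos c) (pos d) → c = v ∧ p = pos v := by
    intro c d hcu hdv hdu hpcd
    obtain rfl : c = v := by
      by_contra hcv
      exact (apply_neg_of_mem_segment (hneg c hcv hcu) (hneg d hdv hdu) hpcd).not_ge hfp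
    exact ⟨rfl, eq_left_of_mem_segment hv.le (hneg d hdv hdu) hpcd hfp⟩
  by_cases hcu : c = u
  · subst hcu
    have hdv : d ≠ v := fun h => hne (h ▸ Sym2.eq_swap)
    exact ⟨c, by simp, by simp, hfrom_u d hdv hcd.symm hp'⟩
  by_cases hdu : d = u
  · subst hdu
    have hcv : c ≠ v := fun h => hne (h ▸ rfl)
    exact ⟨d, by simp, by simp, hfrom_u c hcv hcu (segment_symm ℝ (pos c) (pos d) ▸ hp')⟩
  by_cases hdv : d = v
  · subst hdv
    exact ⟨d, by simp, by simp,
      (hend d c hdu hcd hcu (segment_symm ℝ (pos c) (pos d) ▸ hp')).2⟩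
  · obtain ⟨rfl, hpc⟩ := hend c d hcu hdv hdu hp'
    exact ⟨c, by simp, by simp, hpc⟩

end Separation

/-! ## Circles in general form -/

section CirclePower

variable {E : Type*} [NormedAddCommGroup E] [InnerProductSpace ℝ E]

/-- The affine function `p ↦ ⟪a, p⟫ + c`; the lines that separate vertices are given as zero sets of
such functions. -/
noncomputable def innerAffine (a : E) (c : ℝ) : E →ᵃ[ℝ] ℝ :=
  (innerₛₗ ℝ a).toAffineMap + AffineMap.const ℝ E c

theorem innerAffine_apply (a : E) (c : ℝ) (p : E) : innerAffine a c p = inner ℝ a p + c := rfl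

/-- The power of `p` with respect to the circle with equation `‖p‖ ^ 2 + ⟪a, p⟫ + c = 0`, that is,
with centre `-a / 2`: negative inside the circle and positive outside. -/
noncomputable def circlePower (a : E) (c : ℝ) (p : E) : ℝ := ‖p‖ ^ 2 + innerAffine a c p

theorem circlePower_sub_dist_sq (a : E) (c : ℝ) (x p : E) :
    circlePower a c p - dist p x ^ 2 = innerAffine (a + (2 : ℝ) • x) (c - ‖x‖ ^ 2) p := by
  simp only [circlePower, innerAffine_apply, dist_eq_norm, norm_sub_sq_real, inner_add_left,
    real_inner_smul_left, real_inner_comm p x]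
  ring

theorem cospherical_of_circlePower_eq_zero {a : E} {c : ℝ} {s : Set E}
    (h : ∀ p ∈ s, circlePower a c p = 0) : EuclideanGeometry.Cospherical s := by
  refine ⟨(-1 / 2 : ℝ) • a, √(‖a‖ ^ 2 / 4 - c), fun p hp => ?_⟩
  rw [← Real.sqrt_sq dist_nonneg, dist_eq_norm, norm_sub_sq_real, norm_smul, real_inner_smul_right,
    real_inner_comm, mul_pow]
  congr 1
  have := h p hp
  simp only [circlePower, innerAffine_apply] at this
  norm_num
  linear_combination this

end CirclePower

/-! ## Polar coordinates -/

/-- The point of the plane with polar radius `r` and angle `θ`, measured clockwise from the negative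
first axis, so that the angles in `[0, π / 2]` fill the second quadrant. -/
noncomputable def polarPoint (r θ : ℝ) : Plane := !₂[-(r * Real.cos θ), r * Real.sin θ]

theorem polarPoint_zero (r θ : ℝ) : polarPoint r θ 0 = -(r * Real.cos θ) := rfl

theorem polarPoint_one (r θ : ℝ) : polarPoint r θ 1 = r * Real.sin θ := rfl

theorem inner_polarPoint (r s θ η : ℝ) :
    inner ℝ (polarPoint r θ) (polarPoint s η) = r * s * Real.cos (θ - η) := by
  simp only [PiLp.inner_apply, Fin.sum_univ_two, polarPoint_zero, polarPoint_one,
    RCLike.inner_apply, conj_trivial, Real.cos_sub]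
  ring

theorem norm_sq_polarPoint (r θ : ℝ) : ‖polarPoint r θ‖ ^ 2 = r ^ 2 := by
  rw [← real_inner_self_eq_norm_sq, inner_polarPoint, sub_self, Real.cos_zero]
  ring

theorem norm_polarPoint (r θ : ℝ) : ‖polarPoint r θ‖ = |r| := by
  rw [← abs_norm, ← sq_eq_sq_iff_abs_eq_abs, norm_sq_polarPoint]

theorem dist_sq_polarPoint (r s θ η : ℝ) : dist (polarPoint r θ) (polarPoint s η) ^ 2 =
    r ^ 2 + s ^ 2 - 2 * r * s * Real.cos (θ - η) := by
  rw [dist_eq_norm, norm_sub_sq_real, norm_sq_polarPoint, norm_sq_polarPoint, inner_polarPoint]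
  ring

-- `r * sin |θ - η|` is the distance of the first point from the ray at angle `η`.
theorem mul_sin_le_dist_polarPoint {r s θ η δ a : ℝ} (ha : 0 ≤ a) (hr : a ≤ r) (hδ : 0 ≤ δ)
    (h : δ ≤ |θ - η|) (h' : |θ - η| ≤ Real.pi / 2) :
    a * Real.sin δ ≤ dist (polarPoint r θ) (polarPoint s η) := by
  have hpi := Real.pi_pos
  have hsin : Real.sin δ ≤ Real.sin |θ - η| :=
    Real.sin_le_sin_of_le_of_le_pi_div_two (by linarith) h' h
  have hsin0 : 0 ≤ Real.sin δ := Real.sin_nonneg_of_nonneg_of_le_pi hδ (by linarith)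
  have hfoot : (r * Real.sin |θ - η|) ^ 2 ≤ dist (polarPoint r θ) (polarPoint s η) ^ 2 := by
    rw [dist_sq_polarPoint, ← Real.cos_abs (θ - η)]
    linear_combination r ^ 2 * Real.sin_sq_add_cos_sq |θ - η| +
      sq_nonneg (s - r * Real.cos |θ - η|)
  calc a * Real.sin δ ≤ r * Real.sin |θ - η| := mul_le_mul hr hsin hsin0 (by linarith)
    _ ≤ dist (polarPoint r θ) (polarPoint s η) := (abs_le_of_sq_le_sq' hfoot dist_nonneg).2

/-- The signed distance from the chord of the circle of radius `R` around the origin whose midpoint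
has angle `ψ` and which spans the angles from `ψ - η` to `ψ + η`; it is positive on the outer
side. -/
noncomputable def chordFn (R ψ η : ℝ) : Plane →ᵃ[ℝ] ℝ :=
  innerAffine (polarPoint 1 ψ) (-(R * Real.cos η))

theorem chordFn_polarPoint (R ψ η ρ θ : ℝ) : chordFn R ψ η (polarPoint (R * ρ) θ) =
    R * (ρ * Real.cos (θ - ψ) - Real.cos η) := by
  rw [chordFn, innerAffine_apply, inner_polarPoint, ← Real.cos_neg, neg_sub]
  ring

section Chord

variable {R ψ η ρ θ : ℝ}

theorem mul_cos_le_cos_of_abs_le_pi_div_two (hρ : ρ ≤ 1) (hθ : |θ| ≤ Real.pi / 2) :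
    ρ * Real.cos θ ≤ Real.cos |θ| := by
  rw [Real.cos_abs]
  exact mul_le_of_le_one_left
    (Real.cos_nonneg_of_neg_pi_div_two_le_of_le (abs_le.1 hθ).1 (abs_le.1 hθ).2) hρ

theorem chordFn_polarPoint_nonpos (hR : 0 ≤ R) (hη : 0 ≤ η) (hle : η ≤ |θ - ψ|)
    (hθ : |θ - ψ| ≤ Real.pi / 2) (hρ : ρ ≤ 1) : chordFn R ψ η (polarPoint (R * ρ) θ) ≤ 0 := by
  rw [chordFn_polarPoint]
  refine mul_nonpos_of_nonneg_of_nonpos hR (sub_nonpos.2 ?_)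
  exact (mul_cos_le_cos_of_abs_le_pi_div_two hρ hθ).trans
    (Real.cos_le_cos_of_nonneg_of_le_pi hη (by linarith [Real.pi_pos]) hle)

theorem chordFn_polarPoint_neg (hR : 0 < R) (hη : 0 ≤ η) (hlt : η < |θ - ψ|)
    (hθ : |θ - ψ| ≤ Real.pi / 2) (hρ : ρ ≤ 1) : chordFn R ψ η (polarPoint (R * ρ) θ) < 0 := by
  rw [chordFn_polarPoint]
  refine mul_neg_of_pos_of_neg hR (sub_neg.2 ?_)
  exact (mul_cos_le_cos_of_abs_le_pi_div_two hρ hθ).trans_lt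
    (Real.cos_lt_cos_of_nonneg_of_le_pi hη (by linarith [Real.pi_pos]) hlt)

end Chord

/-! ## The polar radii of the leaves -/

/-- The weight of the chord in the equation of the circle through the leaves of a spine vertex. On
the unit circle, the chord has its ends at the angles `±(μ + ε)`, and the weight is chosen such that
the spine vertex, at the angle `-(μ - ε)`, has power `4` with respect to the circle of the leaves,
more than its squared distance from any leaf. -/
noncomputable def leafWeight (μ ε : ℝ) : ℝ := 2 / (Real.sin μ * Real.sin ε)

/-- The power, with respect to the circle of the leaves, of the point with polar radius `r` at the
angle `φ + ε` from the midpoint of the chord. -/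
noncomputable def leafPower (μ ε φ r : ℝ) : ℝ :=
  r ^ 2 - 1 + leafWeight μ ε * (r * Real.cos (φ + ε) - Real.cos (μ + ε))

/-- The polar radius of the leaf at the angle `φ + ε` from the midpoint of the chord, relative to
the radius of the circle of the spine: the positive root of `leafPower μ ε φ`. -/
noncomputable def leafRadius (μ ε φ : ℝ) : ℝ :=
  (√((leafWeight μ ε * Real.cos (φ + ε)) ^ 2 + 4 * (1 + leafWeight μ ε * Real.cos (μ + ε))) -
    leafWeight μ ε * Real.cos (φ + ε)) / 2

section LeafRadius

variable {μ ε φ r : ℝ}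

theorem leafWeight_pos (hμ : 0 < μ) (hε : 0 < ε) (h : μ + ε ≤ Real.pi / 4) :
    0 < leafWeight μ ε := by
  have hsinμ : 0 < Real.sin μ := Real.sin_pos_of_pos_of_lt_pi hμ (by linarith [Real.pi_pos])
  have hsinε : 0 < Real.sin ε := Real.sin_pos_of_pos_of_lt_pi hε (by linarith [Real.pi_pos])
  exact div_pos two_pos (mul_pos hsinμ hsinε)

theorem leafWeight_mul_sin_mul_sin (hμ : 0 < μ) (hε : 0 < ε) (h : μ + ε ≤ Real.pi / 4) :
    leafWeight μ ε * (Real.sin μ * Real.sin ε) = 2 := by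
  refine div_mul_cancel₀ _ fun h0 => (leafWeight_pos hμ hε h).ne' ?_
  rw [leafWeight, h0, div_zero]

theorem leafWeight_mul_cos_sub_cos (hμ : 0 < μ) (hε : 0 < ε) (h : μ + ε ≤ Real.pi / 4) :
    leafWeight μ ε * (Real.cos (μ - ε) - Real.cos (μ + ε)) = 4 := by
  rw [Real.cos_sub, Real.cos_add]
  linear_combination 2 * leafWeight_mul_sin_mul_sin hμ hε h

theorem half_lt_cos (h0 : 0 ≤ φ) (h : φ ≤ Real.pi / 4) : 1 / 2 < Real.cos φ := by
  have hpi := Real.pi_pos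
  rw [← Real.cos_pi_div_three]
  exact Real.cos_lt_cos_of_nonneg_of_le_pi h0 (by linarith) (by linarith)

theorem one_add_leafWeight_mul_cos_pos (hμ : 0 < μ) (hε : 0 < ε) (h : μ + ε ≤ Real.pi / 4) :
    0 < 1 + leafWeight μ ε * Real.cos (μ + ε) := by
  have hcos : 0 < Real.cos (μ + ε) := by linarith [half_lt_cos (add_pos hμ hε).le h]
  linarith [mul_pos (leafWeight_pos hμ hε h) hcos]

theorem leafPower_leafRadius (hμ : 0 < μ) (hε : 0 < ε) (h : μ + ε ≤ Real.pi / 4) :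
    leafPower μ ε φ (leafRadius μ ε φ) = 0 := by
  have hdiscr : 0 ≤ (leafWeight μ ε * Real.cos (φ + ε)) ^ 2 +
      4 * (1 + leafWeight μ ε * Real.cos (μ + ε)) := by
    linarith [sq_nonneg (leafWeight μ ε * Real.cos (φ + ε)),
      one_add_leafWeight_mul_cos_pos hμ hε h]
  unfold leafPower leafRadius
  linear_combination (1 / 4) * Real.sq_sqrt hdiscr

theorem leafRadius_pos (hμ : 0 < μ) (hε : 0 < ε) (h : μ + ε ≤ Real.pi / 4) :
    0 < leafRadius μ ε φ := by
  refine div_pos (sub_pos.2 (Real.lt_sqrt_of_sq_lt ?_)) two_pos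
  linarith [one_add_leafWeight_mul_cos_pos hμ hε h]

theorem leafPower_monotoneOn (hw : 0 ≤ leafWeight μ ε) (hcos : 0 ≤ Real.cos (φ + ε)) :
    MonotoneOn (leafPower μ ε φ) (Set.Ici 0) := by
  intro r hr s _ hrs
  have hsq : r ^ 2 ≤ s ^ 2 := pow_le_pow_left₀ hr hrs 2
  have hmul := mul_le_mul_of_nonneg_left (mul_le_mul_of_nonneg_right hrs hcos) hw
  unfold leafPower
  linarith

section Leaf

variable (hε : 0 < ε) (h : μ + ε ≤ Real.pi / 4) (hφ : 0 ≤ φ) (hφμ : φ < μ)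

include hε h hφ hφμ

theorem leafRadius_lt_of_leafPower_pos (hr : 0 ≤ r) (hpos : 0 < leafPower μ ε φ r) :
    leafRadius μ ε φ < r := by
  have hμ : 0 < μ := hφ.trans_lt hφμ
  have hcos := half_lt_cos (φ := φ + ε) (by linarith) (by linarith)
  by_contra! hle
  have hmono := leafPower_monotoneOn (leafWeight_pos hμ hε h).le (by linarith) hr
    (leafRadius_pos hμ hε h).le hle
  rw [leafPower_leafRadius hμ hε h] at hmono
  exact hmono.not_gt hpos

theorem lt_leafRadius_of_leafPower_neg (hneg : leafPower μ ε φ r < 0) :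
    r < leafRadius μ ε φ := by
  have hμ : 0 < μ := hφ.trans_lt hφμ
  have hcos := half_lt_cos (φ := φ + ε) (by linarith) (by linarith)
  by_contra! hle
  have hrad := (leafRadius_pos hμ hε h (φ := φ)).le
  have hmono := leafPower_monotoneOn (leafWeight_pos hμ hε h).le (by linarith) hrad
    (hrad.trans hle) hle
  rw [leafPower_leafRadius hμ hε h] at hmono
  exact hmono.not_gt hneg

theorem cos_add_lt_cos_add : Real.cos (μ + ε) < Real.cos (φ + ε) :=
  Real.cos_lt_cos_of_nonneg_of_le_pi (by linarith) (by linarith [Real.pi_pos]) (by linarith)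

theorem leafRadius_lt_one : leafRadius μ ε φ < 1 := by
  refine leafRadius_lt_of_leafPower_pos hε h hφ hφμ zero_le_one ?_
  have := mul_pos (leafWeight_pos (hφ.trans_lt hφμ) hε h)
    (sub_pos.2 (cos_add_lt_cos_add hε h hφ hφμ))
  unfold leafPower
  linarith

theorem cos_add_lt_leafRadius_mul_cos :
    Real.cos (μ + ε) < leafRadius μ ε φ * Real.cos (φ + ε) := by
  have hφcos : 0 < Real.cos (φ + ε) := by
    linarith [half_lt_cos (φ := φ + ε) (by linarith) (by linarith)]
  have hμcos : 0 < Real.cos (μ + ε) := by linarith [half_lt_cos (by linarith) h]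
  rw [← div_lt_iff₀ hφcos]
  refine lt_leafRadius_of_leafPower_neg hε h hφ hφμ ?_
  have hsq := pow_lt_one₀ (div_pos hμcos hφcos).le
    ((div_lt_one hφcos).2 (cos_add_lt_cos_add hε h hφ hφμ)) two_ne_zero
  rw [leafPower, div_mul_cancel₀ _ hφcos.ne', sub_self, mul_zero, add_zero]
  linarith

theorem half_lt_leafRadius : 1 / 2 < leafRadius μ ε φ := by
  calc 1 / 2 < Real.cos (μ + ε) := half_lt_cos (by linarith) h
    _ < leafRadius μ ε φ * Real.cos (φ + ε) := cos_add_lt_leafRadius_mul_cos hε h hφ hφμ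
    _ ≤ leafRadius μ ε φ :=
      mul_le_of_le_one_right (leafRadius_pos (hφ.trans_lt hφμ) hε h).le (Real.cos_le_one _)

omit hφ hφμ in
-- The point is where the ray of the leaf meets the chord between two consecutive spine vertices.
theorem sin_mul_cos_sq_mul_leafPower (hμ : 0 < μ) (hφ : Real.cos φ ≠ 0) :
    Real.sin μ * Real.cos φ ^ 2 * leafPower μ ε φ (Real.cos μ / Real.cos φ) =
      Real.sin (μ - φ) * (2 * Real.cos φ - Real.sin μ * Real.sin (μ + φ)) := by
  set r := Real.cos μ / Real.cos φ
  have hr : r * Real.cos φ = Real.cos μ := div_mul_cancel₀ _ hφ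
  have hchord : Real.cos φ * (r * Real.cos (φ + ε) - Real.cos (μ + ε)) =
      Real.sin ε * Real.sin (μ - φ) := by
    simp only [Real.cos_add, Real.sin_sub]
    linear_combination (Real.cos φ * Real.cos ε - Real.sin φ * Real.sin ε) * hr
  have hcircle : Real.cos φ ^ 2 * (r ^ 2 - 1) = -(Real.sin (μ - φ) * Real.sin (μ + φ)) := by
    rw [Real.sin_sub, Real.sin_add]
    linear_combination (r * Real.cos φ + Real.cos μ) * hr +
      Real.cos φ ^ 2 * Real.sin_sq_add_cos_sq μ - Real.cos μ ^ 2 * Real.sin_sq_add_cos_sq φ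
  unfold leafPower
  linear_combination Real.sin μ * hcircle + Real.sin μ * leafWeight μ ε * Real.cos φ * hchord +
    Real.cos φ * Real.sin (μ - φ) * leafWeight_mul_sin_mul_sin hμ hε h

theorem leafRadius_mul_cos_lt : leafRadius μ ε φ * Real.cos φ < Real.cos μ := by
  have hμ : 0 < μ := hφ.trans_lt hφμ
  have hφcos : 1 / 2 < Real.cos φ := half_lt_cos hφ (by linarith)
  have hφcos0 : 0 < Real.cos φ := by linarith
  have hμcos : 1 / 2 < Real.cos μ := half_lt_cos hμ.le (by linarith)
  have hμsin : 0 < Real.sin μ := Real.sin_pos_of_pos_of_lt_pi hμ (by linarith [Real.pi_pos])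
  rw [← lt_div_iff₀ hφcos0]
  refine leafRadius_lt_of_leafPower_pos hε h hφ hφμ (by positivity) ?_
  have hsin : 0 < Real.sin (μ - φ) :=
    Real.sin_pos_of_pos_of_lt_pi (by linarith) (by linarith [Real.pi_pos])
  have hprod : Real.sin μ * Real.sin (μ + φ) ≤ 1 :=
    (mul_le_of_le_one_right hμsin.le (Real.sin_le_one _)).trans (Real.sin_le_one _)
  have hpos := mul_pos hsin (sub_pos.2 (hprod.trans_lt (by linarith : 1 < 2 * Real.cos φ)))
  rw [← sin_mul_cos_sq_mul_leafPower hε h hμ hφcos0.ne'] at hpos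
  exact pos_of_mul_pos_right hpos (mul_pos hμsin (pow_pos hφcos0 2)).le

end Leaf

end LeafRadius

/-! ## Block layouts -/

/-- The angle between consecutive slots on the circle of the spine, if there are `n` vertices: the
slots `0, …, 2 * n + 2` fill a quarter of the circle. -/
noncomputable def slotAngle (n : ℕ) : ℝ := Real.pi / (4 * (n + 1))

/-- The radius of the circle of the spine, if there are `n` vertices. -/
noncomputable def spineRadius (n : ℕ) : ℝ := 4 * (n + 1)

theorem slotAngle_pos (n : ℕ) : 0 < slotAngle n := div_pos Real.pi_pos (by positivity)

theorem spineRadius_pos (n : ℕ) : 0 < spineRadius n := mul_pos four_pos (by positivity)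

theorem slotCount_mul_slotAngle (n : ℕ) : (2 * n + 2) * slotAngle n = Real.pi / 2 := by
  unfold slotAngle
  field

theorem mul_slotAngle_le_pi_div_two {n : ℕ} {x : ℝ} (hx : x ≤ 2 * n + 2) :
    x * slotAngle n ≤ Real.pi / 2 := by
  rw [← slotCount_mul_slotAngle n]
  exact mul_le_mul_of_nonneg_right hx (slotAngle_pos n).le

theorem one_le_half_spineRadius_mul_sin_slotAngle (n : ℕ) :
    1 ≤ spineRadius n * (1 / 2) * Real.sin (slotAngle n) := by
  have hle : slotAngle n ≤ Real.pi / 2 := by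
    simpa using mul_slotAngle_le_pi_div_two (n := n) (x := 1)
      (by linarith [n.cast_nonneg (α := ℝ)])
  calc 1 = spineRadius n * (1 / 2) * (2 / Real.pi * slotAngle n) := by
        unfold spineRadius slotAngle
        field
    _ ≤ spineRadius n * (1 / 2) * Real.sin (slotAngle n) :=
        mul_le_mul_of_nonneg_left (Real.mul_le_sin (slotAngle_pos n).le hle)
          (by linarith [spineRadius_pos n])

/-- A placement of the vertices of a caterpillar into slots on the circle of the spine. Each spine
vertex has a block of slots, disjoint from the others; it takes the first slot of its block itself,
and its leaves take slots in the second half of the block. -/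
structure BlockLayout (V : Type*) where
  /-- The number of vertices. -/
  n : ℕ
  /-- The vertices that are drawn on the circle. -/
  spine : Set V
  /-- The spine vertex adjacent to a leaf. -/
  parent : V → V
  /-- The first slot of the block of a spine vertex. -/
  start : V → ℕ
  /-- Half the number of slots in the block of a spine vertex. -/
  half : V → ℕ
  /-- The position of a leaf among the leaves of its spine vertex. -/
  idx : V → ℕ
  one_le_half : ∀ v, 1 ≤ half v
  half_le : ∀ v, half v ≤ n
  start_pos : ∀ v ∈ spine, 1 ≤ start v
  start_le : ∀ v ∈ spine, start v + 2 * half v ≤ 2 * n + 1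
  disjoint : ∀ u ∈ spine, ∀ v ∈ spine, u ≠ v →
    start u + 2 * half u ≤ start v ∨ start v + 2 * half v ≤ start u
  parent_mem : ∀ v ∉ spine, parent v ∈ spine
  idx_lt : ∀ v ∉ spine, idx v + 1 < half (parent v)
  idx_inj : ∀ u ∉ spine, ∀ v ∉ spine, parent u = parent v → idx u = idx v → u = v

namespace BlockLayout

variable {V : Type*} (l : BlockLayout V)

open Classical in
/-- The slot of a vertex; slot `i` is the ray at the angle `i * slotAngle n`. -/
noncomputable def slot (v : V) : ℕ :=
  if v ∈ l.spine then l.start v else l.start (l.parent v) + l.half (l.parent v) + l.idx v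

open Classical in
/-- The polar radius of a vertex, relative to the radius of the circle of the spine. -/
noncomputable def rad (v : V) : ℝ :=
  if v ∈ l.spine then 1 else
    leafRadius (l.half (l.parent v) * slotAngle l.n) (slotAngle l.n / 2) (l.idx v * slotAngle l.n)

/-- The drawing of a block layout. -/
noncomputable def pos (v : V) : Plane :=
  polarPoint (spineRadius l.n * l.rad v) (l.slot v * slotAngle l.n)

open Classical in
/-- The spine vertex in whose block a vertex is placed. -/
noncomputable def owner (v : V) : V := if v ∈ l.spine then v else l.parent v

section

variable {l} {v : V}

theorem slot_of_mem (h : v ∈ l.spine) : l.slot v = l.start v := if_pos h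

theorem slot_of_notMem (h : v ∉ l.spine) :
    l.slot v = l.start (l.parent v) + l.half (l.parent v) + l.idx v := if_neg h

theorem rad_of_mem (h : v ∈ l.spine) : l.rad v = 1 := if_pos h

theorem rad_of_notMem (h : v ∉ l.spine) : l.rad v =
    leafRadius (l.half (l.parent v) * slotAngle l.n) (slotAngle l.n / 2)
      (l.idx v * slotAngle l.n) := if_neg h

theorem owner_of_mem (h : v ∈ l.spine) : l.owner v = v := if_pos h

theorem owner_of_notMem (h : v ∉ l.spine) : l.owner v = l.parent v := if_neg h

end

theorem owner_mem (v : V) : l.owner v ∈ l.spine := by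
  by_cases h : v ∈ l.spine
  · rwa [owner_of_mem h]
  · rw [owner_of_notMem h]
    exact l.parent_mem v h

variable {l} in
theorem parent_eq_of_owner_eq {q u : V} (ho : l.owner q = u) (hqu : q ≠ u) :
    q ∉ l.spine ∧ l.parent q = u := by
  by_cases h : q ∈ l.spine
  · exact absurd ((owner_of_mem h).symm.trans ho) hqu
  · exact ⟨h, (owner_of_notMem h).symm.trans ho⟩

theorem slot_mem_block (v : V) : l.start (l.owner v) ≤ l.slot v ∧
    l.slot v + 2 ≤ l.start (l.owner v) + 2 * l.half (l.owner v) := by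
  by_cases h : v ∈ l.spine
  · rw [owner_of_mem h, slot_of_mem h]
    have := l.one_le_half v
    omega
  · rw [owner_of_notMem h, slot_of_notMem h]
    have := l.idx_lt v h
    omega

variable {l} in
theorem slot_of_owner_ne {q u : V} (hu : u ∈ l.spine) (h : l.owner q ≠ u) :
    l.slot q + 2 ≤ l.start u ∨ l.start u + 2 * l.half u ≤ l.slot q := by
  have hdisj := l.disjoint _ (l.owner_mem q) _ hu h
  have hblock := l.slot_mem_block q
  omega

theorem slot_bounds (v : V) : 1 ≤ l.slot v ∧ l.slot v + 1 ≤ 2 * l.n := by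
  have hstart := l.start_pos _ (l.owner_mem v)
  have hend := l.start_le _ (l.owner_mem v)
  have hblock := l.slot_mem_block v
  omega

theorem slot_cast_bounds (v : V) : (1 : ℝ) ≤ l.slot v ∧ (l.slot v : ℝ) + 1 ≤ 2 * l.n := by
  exact_mod_cast l.slot_bounds v

theorem slot_ne_of_parent_eq {u v : V} (hu : u ∈ l.spine) (hv : v ∉ l.spine)
    (h : l.parent v = u) : l.slot u ≠ l.slot v := by
  rw [slot_of_mem hu, slot_of_notMem hv, h]
  have := l.one_le_half u
  omega

theorem slot_injective : Function.Injective l.slot := by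
  intro u v huv
  by_cases ho : l.owner u = l.owner v
  · by_cases hu : u ∈ l.spine <;> by_cases hv : v ∈ l.spine <;>
      simp only [owner_of_mem, owner_of_notMem, hu, hv, not_false_eq_true] at ho
    · exact ho
    · exact absurd huv (l.slot_ne_of_parent_eq hu hv ho.symm)
    · exact absurd huv.symm (l.slot_ne_of_parent_eq hv hu ho)
    · rw [slot_of_notMem hu, slot_of_notMem hv, ho] at huv
      exact l.idx_inj u hu v hv ho (by omega)
  · have hdisj := slot_of_owner_ne (l.owner_mem v) ho
    have hblock := l.slot_mem_block v
    omega

theorem one_le_half_cast (v : V) : (1 : ℝ) ≤ l.half v := by exact_mod_cast l.one_le_half v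

theorem half_mul_slotAngle_pos (v : V) : 0 < l.half v * slotAngle l.n :=
  mul_pos (by linarith [l.one_le_half_cast v]) (slotAngle_pos _)

theorem half_slotAngle_pos : 0 < slotAngle l.n / 2 := half_pos (slotAngle_pos _)

theorem half_mul_slotAngle_add_le (v : V) :
    l.half v * slotAngle l.n + slotAngle l.n / 2 ≤ Real.pi / 4 := by
  have hhalf : (l.half v : ℝ) ≤ l.n := by exact_mod_cast l.half_le v
  have := mul_slotAngle_le_pi_div_two (n := l.n) (x := 2 * l.half v + 1) (by linarith)
  linarith

theorem idx_mul_slotAngle_nonneg (v : V) : 0 ≤ l.idx v * slotAngle l.n :=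
  mul_nonneg (Nat.cast_nonneg _) (slotAngle_pos _).le

variable {l} in
theorem idx_mul_slotAngle_lt {v : V} (hv : v ∉ l.spine) :
    l.idx v * slotAngle l.n < l.half (l.parent v) * slotAngle l.n :=
  mul_lt_mul_of_pos_right (by exact_mod_cast (Nat.lt_of_succ_lt (l.idx_lt v hv)))
    (slotAngle_pos _)

variable {l} in
theorem rad_lt_one {v : V} (hv : v ∉ l.spine) : l.rad v < 1 := by
  rw [rad_of_notMem hv]
  exact leafRadius_lt_one l.half_slotAngle_pos (l.half_mul_slotAngle_add_le _)
    (l.idx_mul_slotAngle_nonneg v) (idx_mul_slotAngle_lt hv)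

theorem rad_le_one (v : V) : l.rad v ≤ 1 := by
  by_cases h : v ∈ l.spine
  · exact (rad_of_mem h).le
  · exact (rad_lt_one h).le

theorem half_lt_rad (v : V) : 1 / 2 < l.rad v := by
  by_cases h : v ∈ l.spine
  · rw [rad_of_mem h]
    norm_num
  · rw [rad_of_notMem h]
    exact half_lt_leafRadius l.half_slotAngle_pos (l.half_mul_slotAngle_add_le _)
      (l.idx_mul_slotAngle_nonneg v) (idx_mul_slotAngle_lt h)

theorem spineRadius_mul_rad_pos (v : V) : 0 < spineRadius l.n * l.rad v :=
  mul_pos (spineRadius_pos _) (by linarith [l.half_lt_rad v])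

theorem spineRadius_mul_rad_le (v : V) : spineRadius l.n * l.rad v ≤ spineRadius l.n :=
  mul_le_of_le_one_right (spineRadius_pos _).le (l.rad_le_one v)

theorem dist_pos_zero (v : V) : dist (l.pos v) 0 = spineRadius l.n * l.rad v := by
  rw [dist_zero_right, pos, norm_polarPoint, abs_of_pos (l.spineRadius_mul_rad_pos v)]

theorem abs_slot_sub_mul_le {x : ℝ} (h0 : 0 ≤ x) (hx : x ≤ 2 * l.n + 2) (v : V) :
    |l.slot v * slotAngle l.n - x * slotAngle l.n| ≤ Real.pi / 2 := by
  have hs := l.slot_cast_bounds v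
  rw [← sub_mul, abs_mul, abs_of_pos (slotAngle_pos l.n)]
  exact mul_slotAngle_le_pi_div_two (abs_le.2 ⟨by linarith, by linarith⟩)

theorem hasUnitResolution : HasUnitResolution l.pos := by
  intro u v hne
  have hv := l.slot_cast_bounds v
  have hone : 1 ≤ |(l.slot u : ℝ) - l.slot v| := by
    have : (1 : ℤ) ≤ |(l.slot u : ℤ) - l.slot v| :=
      Int.one_le_abs (sub_ne_zero.2 (Nat.cast_injective.ne (l.slot_injective.ne hne)))
    exact_mod_cast this
  have hsep : slotAngle l.n ≤ |l.slot u * slotAngle l.n - l.slot v * slotAngle l.n| := by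
    rw [← sub_mul, abs_mul, abs_of_pos (slotAngle_pos l.n)]
    exact le_mul_of_one_le_left (slotAngle_pos l.n).le hone
  calc 1 ≤ spineRadius l.n * (1 / 2) * Real.sin (slotAngle l.n) :=
        one_le_half_spineRadius_mul_sin_slotAngle _
    _ ≤ dist (l.pos u) (l.pos v) :=
        mul_sin_le_dist_polarPoint (by linarith [spineRadius_pos l.n])
          (mul_le_mul_of_nonneg_left (l.half_lt_rad u).le (spineRadius_pos _).le)
          (slotAngle_pos _).le hsep (l.abs_slot_sub_mul_le (by linarith) (by linarith) u)

theorem pos_injective : Function.Injective l.pos := by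
  intro u v huv
  by_contra hne
  have := l.hasUnitResolution u v hne
  rw [huv, dist_self] at this
  linarith

/-- The affine function of the chord with midpoint at slot `y` and ends at the slots `y - h` and
`y + h`. -/
noncomputable def slotChord (y h : ℝ) : Plane →ᵃ[ℝ] ℝ :=
  chordFn (spineRadius l.n) (y * slotAngle l.n) (h * slotAngle l.n)

theorem slotChord_pos (y h : ℝ) (v : V) : l.slotChord y h (l.pos v) = spineRadius l.n *
    (l.rad v * Real.cos ((l.slot v - y) * slotAngle l.n) - Real.cos (h * slotAngle l.n)) := by
  rw [slotChord, pos, chordFn_polarPoint, sub_mul]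

section SlotChord

variable {l} {y h : ℝ} {q : V}

theorem slotChord_pos_nonpos (h0 : 0 ≤ h) (hy0 : 0 ≤ y) (hy : y ≤ 2 * l.n + 2)
    (hq : (l.slot q : ℝ) ≤ y - h ∨ y + h ≤ l.slot q) : l.slotChord y h (l.pos q) ≤ 0 := by
  refine chordFn_polarPoint_nonpos (spineRadius_pos _).le (mul_nonneg h0 (slotAngle_pos _).le) ?_
    (l.abs_slot_sub_mul_le hy0 hy q) (l.rad_le_one q)
  rw [← sub_mul, abs_mul, abs_of_pos (slotAngle_pos l.n)]
  refine mul_le_mul_of_nonneg_right (le_abs.2 ?_) (slotAngle_pos _).le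
  rcases hq with hq | hq
  · exact Or.inr (by linarith)
  · exact Or.inl (by linarith)

theorem slotChord_pos_neg (h0 : 0 ≤ h) (hy0 : 0 ≤ y) (hy : y ≤ 2 * l.n + 2)
    (hq : (l.slot q : ℝ) < y - h ∨ y + h < l.slot q) : l.slotChord y h (l.pos q) < 0 := by
  refine chordFn_polarPoint_neg (spineRadius_pos _) (mul_nonneg h0 (slotAngle_pos _).le) ?_
    (l.abs_slot_sub_mul_le hy0 hy q) (l.rad_le_one q)
  rw [← sub_mul, abs_mul, abs_of_pos (slotAngle_pos l.n)]
  refine mul_lt_mul_of_pos_right (lt_abs.2 ?_) (slotAngle_pos _)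
  rcases hq with hq | hq
  · exact Or.inr (by linarith)
  · exact Or.inl (by linarith)

end SlotChord

section Support

variable {l} {u v q : V}

theorem start_cast_bounds (hu : u ∈ l.spine) :
    (1 : ℝ) ≤ l.start u ∧ (l.start u : ℝ) + 2 * l.half u ≤ 2 * l.n + 1 :=
  ⟨by exact_mod_cast l.start_pos u hu, by exact_mod_cast l.start_le u hu⟩

theorem slot_cast_of_owner_ne (hu : u ∈ l.spine) (h : l.owner q ≠ u) :
    (l.slot q : ℝ) + 2 ≤ l.start u ∨ (l.start u : ℝ) + 2 * l.half u ≤ l.slot q := by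
  exact_mod_cast slot_of_owner_ne hu h

theorem slotChord_tangent_pos_eq_zero (hv : v ∈ l.spine) :
    l.slotChord (l.slot v) 0 (l.pos v) = 0 := by
  simp [slotChord_pos, rad_of_mem hv]

theorem slotChord_tangent_pos_neg (h : q ≠ v) : l.slotChord (l.slot v) 0 (l.pos q) < 0 := by
  have hs := l.slot_cast_bounds v
  refine slotChord_pos_neg le_rfl (by linarith) (by linarith) ?_
  rw [sub_zero, add_zero, Nat.cast_lt, Nat.cast_lt]
  exact lt_or_gt_of_ne (l.slot_injective.ne h)

variable (l) in
/-- The affine function of the chord between the first slots of the block of `u` and the next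
block. -/
noncomputable def blockChord (u : V) : Plane →ᵃ[ℝ] ℝ :=
  l.slotChord (l.start u + l.half u) (l.half u)

theorem blockChord_pos_eq_zero (hu : u ∈ l.spine) : l.blockChord u (l.pos u) = 0 := by
  have hangle : ((l.start u : ℝ) - (l.start u + l.half u)) * slotAngle l.n =
    -(l.half u * slotAngle l.n) := by ring
  rw [blockChord, slotChord_pos, slot_of_mem hu, rad_of_mem hu, hangle, Real.cos_neg]
  ring

theorem blockChord_next_pos_eq_zero (hv : v ∈ l.spine)
    (h : l.slot v = l.start u + 2 * l.half u) : l.blockChord u (l.pos v) = 0 := by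
  have hangle : ((l.start u : ℝ) + 2 * l.half u - (l.start u + l.half u)) * slotAngle l.n =
    l.half u * slotAngle l.n := by ring
  rw [blockChord, slotChord_pos, rad_of_mem hv, h]
  push_cast
  rw [hangle]
  ring

theorem blockChord_leaf_pos_neg (hv : v ∉ l.spine) :
    l.blockChord (l.parent v) (l.pos v) < 0 := by
  have hlt := leafRadius_mul_cos_lt l.half_slotAngle_pos (l.half_mul_slotAngle_add_le _)
    (l.idx_mul_slotAngle_nonneg v) (idx_mul_slotAngle_lt hv)
  rw [← rad_of_notMem hv] at hlt
  rw [blockChord, slotChord_pos, slot_of_notMem hv]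
  push_cast
  rw [add_sub_cancel_left]
  exact mul_neg_of_pos_of_neg (spineRadius_pos _) (sub_neg.2 hlt)

theorem blockChord_pos_neg (hu : u ∈ l.spine) (hqu : q ≠ u)
    (hq : l.slot q ≠ l.start u + 2 * l.half u) : l.blockChord u (l.pos q) < 0 := by
  by_cases ho : l.owner q = u
  · obtain ⟨hleaf, rfl⟩ := parent_eq_of_owner_eq ho hqu
    exact blockChord_leaf_pos_neg hleaf
  · have hb := start_cast_bounds hu
    have hh := l.one_le_half_cast u
    refine slotChord_pos_neg (by linarith) (by linarith) (by linarith) ?_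
    rcases slot_of_owner_ne hu ho with hlt | hgt
    · have : (l.slot q : ℝ) + 2 ≤ l.start u := by exact_mod_cast hlt
      exact Or.inl (by linarith)
    · have : (l.start u : ℝ) + 2 * l.half u < l.slot q := by
        exact_mod_cast hgt.lt_of_ne' hq
      exact Or.inr (by linarith)

theorem isUncrossed_of_slot_eq (hu : u ∈ l.spine) (hv : v ∈ l.spine)
    (h : l.start v = l.start u + 2 * l.half u) : IsUncrossed l.pos u v := by
  rw [← slot_of_mem hv] at h
  refine isUncrossed_of_supporting_line (blockChord_pos_eq_zero hu)
    (blockChord_next_pos_eq_zero hv h) fun q hqu hqv => blockChord_pos_neg hu hqu ?_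
  rw [← h]
  exact l.slot_injective.ne hqv

end Support

/-! ## The circles of the leaves -/

/-- The weight of the chord in the equation of the circle of the leaves of `u`. -/
noncomputable def chordWeight (u : V) : ℝ :=
  spineRadius l.n * leafWeight (l.half u * slotAngle l.n) (slotAngle l.n / 2)

/-- The affine function of the chord in the equation of the circle of the leaves of `u`; it cuts off
the slots from `l.start u` to `l.start u + 2 * l.half u - 1`, which form the block of `u`. -/
noncomputable def leafChord (u : V) : Plane →ᵃ[ℝ] ℝ :=
  l.slotChord (l.start u + l.half u - 1 / 2) (l.half u + 1 / 2)

/-- The power with respect to the circle of the leaves of `u`. This circle belongs to the pencil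
spanned by the circle of the spine and the line of `l.leafChord u`. -/
noncomputable def leafCirclePower (u : V) : Plane → ℝ :=
  circlePower
    (l.chordWeight u • polarPoint 1 ((l.start u + l.half u - 1 / 2) * slotAngle l.n))
    (-(spineRadius l.n ^ 2 + l.chordWeight u *
      (spineRadius l.n * Real.cos ((l.half u + 1 / 2) * slotAngle l.n))))

theorem leafCirclePower_apply (u : V) (p : Plane) : l.leafCirclePower u p =
    ‖p‖ ^ 2 - spineRadius l.n ^ 2 + l.chordWeight u * l.leafChord u p := by
  simp only [leafCirclePower, circlePower, leafChord, slotChord, chordFn, innerAffine_apply,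
    real_inner_smul_left]
  ring

theorem chordWeight_pos (u : V) : 0 < l.chordWeight u :=
  mul_pos (spineRadius_pos _) (leafWeight_pos (l.half_mul_slotAngle_pos u) l.half_slotAngle_pos
    (l.half_mul_slotAngle_add_le u))

theorem norm_sq_pos (v : V) : ‖l.pos v‖ ^ 2 = (spineRadius l.n * l.rad v) ^ 2 :=
  norm_sq_polarPoint _ _

theorem norm_sq_pos_le (v : V) : ‖l.pos v‖ ^ 2 ≤ spineRadius l.n ^ 2 := by
  rw [norm_sq_pos]
  exact pow_le_pow_left₀ (l.spineRadius_mul_rad_pos v).le (l.spineRadius_mul_rad_le v) 2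

section

variable {l} {u v q : V}

theorem leafCirclePower_leaf_pos (hv : v ∉ l.spine) :
    l.leafCirclePower (l.parent v) (l.pos v) = 0 := by
  have hpow := leafPower_leafRadius (φ := l.idx v * slotAngle l.n)
    (l.half_mul_slotAngle_pos (l.parent v)) l.half_slotAngle_pos
    (l.half_mul_slotAngle_add_le (l.parent v))
  have hangle : ((l.start (l.parent v) + l.half (l.parent v) + l.idx v -
    (l.start (l.parent v) + l.half (l.parent v) - 1 / 2) : ℝ)) * slotAngle l.n =
      l.idx v * slotAngle l.n + slotAngle l.n / 2 := by ring
  rw [← rad_of_notMem hv, leafPower] at hpow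
  rw [leafCirclePower_apply, norm_sq_pos, leafChord, slotChord_pos, slot_of_notMem hv, chordWeight]
  push_cast
  rw [hangle, show (l.half (l.parent v) + 1 / 2) * slotAngle l.n =
    l.half (l.parent v) * slotAngle l.n + slotAngle l.n / 2 by ring]
  linear_combination spineRadius l.n ^ 2 * hpow

theorem leafCirclePower_parent_pos (hu : u ∈ l.spine) :
    l.leafCirclePower u (l.pos u) = 4 * spineRadius l.n ^ 2 := by
  have hweight := leafWeight_mul_cos_sub_cos (l.half_mul_slotAngle_pos u) l.half_slotAngle_pos
    (l.half_mul_slotAngle_add_le u)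
  have hangle : ((l.start u : ℝ) - (l.start u + l.half u - 1 / 2)) * slotAngle l.n =
    -(l.half u * slotAngle l.n - slotAngle l.n / 2) := by ring
  rw [leafCirclePower_apply, norm_sq_pos, leafChord, slotChord_pos, slot_of_mem hu, rad_of_mem hu,
    hangle, Real.cos_neg, chordWeight, show (l.half u + 1 / 2) * slotAngle l.n =
    l.half u * slotAngle l.n + slotAngle l.n / 2 by ring]
  linear_combination spineRadius l.n ^ 2 * hweight

theorem leafChord_pos_nonpos (hu : u ∈ l.spine) (ho : l.owner q ≠ u) :
    l.leafChord u (l.pos q) ≤ 0 := by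
  have hb := start_cast_bounds hu
  have hh := l.one_le_half_cast u
  refine slotChord_pos_nonpos (by linarith) (by linarith) (by linarith) ?_
  rcases slot_cast_of_owner_ne hu ho with h | h
  · exact Or.inl (by linarith)
  · exact Or.inr (by linarith)

theorem leafCirclePower_pos_nonpos (hu : u ∈ l.spine) (hqu : q ≠ u) :
    l.leafCirclePower u (l.pos q) ≤ 0 := by
  by_cases ho : l.owner q = u
  · obtain ⟨hleaf, rfl⟩ := parent_eq_of_owner_eq ho hqu
    exact (leafCirclePower_leaf_pos hleaf).le
  · rw [leafCirclePower_apply]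
    have hchord := mul_nonpos_of_nonneg_of_nonpos (l.chordWeight_pos u).le
      (leafChord_pos_nonpos hu ho)
    linarith [l.norm_sq_pos_le q]

variable (l) in
theorem dist_sq_pos_le (u v : V) : dist (l.pos u) (l.pos v) ^ 2 ≤ 2 * spineRadius l.n ^ 2 := by
  have hv := l.slot_cast_bounds v
  have hcos : 0 ≤ Real.cos (l.slot u * slotAngle l.n - l.slot v * slotAngle l.n) :=
    Real.cos_nonneg_of_mem_Icc
      (abs_le.1 (l.abs_slot_sub_mul_le (by linarith) (by linarith) u))
  have hinner : 0 ≤ inner ℝ (l.pos u) (l.pos v) := by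
    rw [pos, pos, inner_polarPoint]
    exact mul_nonneg (mul_pos (l.spineRadius_mul_rad_pos u) (l.spineRadius_mul_rad_pos v)).le hcos
  rw [dist_eq_norm, norm_sub_sq_real]
  linarith [l.norm_sq_pos_le u, l.norm_sq_pos_le v]

variable (l) in
/-- The affine function that separates a leaf and its spine vertex from all other vertices. Its line
is the tangent at the leaf of the circle of the leaves. -/
noncomputable def leafTangent (v : V) : Plane →ᵃ[ℝ] ℝ :=
  innerAffine
    (l.chordWeight (l.parent v) •
      polarPoint 1 ((l.start (l.parent v) + l.half (l.parent v) - 1 / 2) * slotAngle l.n) +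
      (2 : ℝ) • l.pos v)
    (-(spineRadius l.n ^ 2 + l.chordWeight (l.parent v) *
      (spineRadius l.n * Real.cos ((l.half (l.parent v) + 1 / 2) * slotAngle l.n))) -
      ‖l.pos v‖ ^ 2)

variable (l) in
theorem leafTangent_apply (v : V) (p : Plane) : l.leafTangent v p =
    l.leafCirclePower (l.parent v) p - dist p (l.pos v) ^ 2 :=
  (circlePower_sub_dist_sq _ _ _ _).symm

theorem leafTangent_pos_eq_zero (hv : v ∉ l.spine) : l.leafTangent v (l.pos v) = 0 := by
  simp [leafTangent_apply, leafCirclePower_leaf_pos hv]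

theorem leafTangent_parent_pos_pos (hv : v ∉ l.spine) :
    0 < l.leafTangent v (l.pos (l.parent v)) := by
  rw [leafTangent_apply, leafCirclePower_parent_pos (l.parent_mem v hv)]
  linarith [l.dist_sq_pos_le (l.parent v) v, pow_pos (spineRadius_pos l.n) 2]

theorem leafTangent_pos_neg (hv : v ∉ l.spine) (hqv : q ≠ v) (hqu : q ≠ l.parent v) :
    l.leafTangent v (l.pos q) < 0 := by
  have hdist : 0 < dist (l.pos q) (l.pos v) := dist_pos.2 (l.pos_injective.ne hqv)
  rw [leafTangent_apply]
  linarith [leafCirclePower_pos_nonpos (l.parent_mem v hv) hqu, pow_pos hdist 2]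

theorem pos_notMem_segment_of_parent_eq (hv : v ∉ l.spine) (hq : q ∉ l.spine) (hqv : q ≠ v)
    (h : l.parent q = l.parent v) : l.pos v ∉ segment ℝ (l.pos (l.parent v)) (l.pos q) := by
  intro hmem
  have hparent := leafTangent_parent_pos_pos hq
  rw [h] at hparent
  refine (apply_nonneg_of_mem_segment hparent.le (leafTangent_pos_eq_zero hq).ge hmem).not_gt ?_
  refine leafTangent_pos_neg hq hqv.symm fun hvu => hv ?_
  rw [hvu]
  exact l.parent_mem q hq

theorem pos_notMem_segment_of_slot_eq (hv : v ∉ l.spine) (hq : q ∈ l.spine)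
    (h : l.slot q = l.start (l.parent v) + 2 * l.half (l.parent v)) :
    l.pos v ∉ segment ℝ (l.pos (l.parent v)) (l.pos q) := fun hmem =>
  (apply_nonneg_of_mem_segment (blockChord_pos_eq_zero (l.parent_mem v hv)).ge
    (blockChord_next_pos_eq_zero hq h).ge hmem).not_gt (blockChord_leaf_pos_neg hv)

variable (l) in
/-- The affine function of the chord that cuts off the slots from `l.start u + 1` to
`l.start u + 2 * l.half u`, which include those of the leaves of `u`. -/
noncomputable def shiftedChord (u : V) : Plane →ᵃ[ℝ] ℝ :=
  l.slotChord (l.start u + l.half u + 1 / 2) (l.half u + 1 / 2)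

theorem shiftedChord_leaf_pos_pos (hv : v ∉ l.spine) :
    0 < l.shiftedChord (l.parent v) (l.pos v) := by
  have hlt := cos_add_lt_leafRadius_mul_cos l.half_slotAngle_pos (l.half_mul_slotAngle_add_le _)
    (l.idx_mul_slotAngle_nonneg v) (idx_mul_slotAngle_lt hv)
  have hidx := l.idx_mul_slotAngle_nonneg v
  have hcos : Real.cos (l.idx v * slotAngle l.n + slotAngle l.n / 2) ≤
      Real.cos ((l.idx v - 1 / 2) * slotAngle l.n) := by
    rw [← Real.cos_abs ((_ - _) * _)]
    refine Real.cos_le_cos_of_nonneg_of_le_pi (abs_nonneg _) ?_ (abs_le.2 ⟨?_, ?_⟩)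
    · linarith [l.half_mul_slotAngle_add_le (l.parent v), idx_mul_slotAngle_lt hv, Real.pi_pos]
    all_goals linarith [slotAngle_pos l.n]
  rw [← rad_of_notMem hv] at hlt
  rw [shiftedChord, slotChord_pos, slot_of_notMem hv]
  push_cast
  rw [show (l.start (l.parent v) + l.half (l.parent v) + l.idx v -
    (l.start (l.parent v) + l.half (l.parent v) + 1 / 2) : ℝ) = l.idx v - 1 / 2 by ring,
    show (l.half (l.parent v) + 1 / 2) * slotAngle l.n =
      l.half (l.parent v) * slotAngle l.n + slotAngle l.n / 2 by ring]
  refine mul_pos (spineRadius_pos _) (sub_pos.2 (hlt.trans_le ?_))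
  exact mul_le_mul_of_nonneg_left hcos (by linarith [l.half_lt_rad v])

theorem shiftedChord_pos_nonpos (hu : u ∈ l.spine) (ho : l.owner q = u → q = u)
    (hq : l.slot q ≠ l.start u + 2 * l.half u) : l.shiftedChord u (l.pos q) ≤ 0 := by
  have hb := start_cast_bounds hu
  have hh := l.one_le_half_cast u
  refine slotChord_pos_nonpos (by linarith) (by linarith) (by linarith) ?_
  by_cases hqu : q = u
  · left
    rw [hqu, slot_of_mem hu]
    linarith
  rcases slot_of_owner_ne hu (mt ho hqu) with h | h
  · have : (l.slot q : ℝ) + 2 ≤ l.start u := by exact_mod_cast h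
    exact Or.inl (by linarith)
  · have : (l.start u : ℝ) + 2 * l.half u + 1 ≤ l.slot q := by
      exact_mod_cast h.lt_of_ne' hq
    exact Or.inr (by linarith)

theorem pos_notMem_segment_of_owner_ne (hv : v ∉ l.spine) (ho : l.owner q ≠ l.parent v)
    (hq : l.slot q ≠ l.start (l.parent v) + 2 * l.half (l.parent v)) :
    l.pos v ∉ segment ℝ (l.pos (l.parent v)) (l.pos q) := by
  intro hmem
  have hu := l.parent_mem v hv
  have hself : l.slot (l.parent v) ≠ l.start (l.parent v) + 2 * l.half (l.parent v) := by
    rw [slot_of_mem hu]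
    have := l.one_le_half (l.parent v)
    omega
  exact ((convex_Iic (0 : ℝ)).affine_preimage (l.shiftedChord (l.parent v))).segment_subset
    (shiftedChord_pos_nonpos hu (fun _ => rfl) hself)
    (shiftedChord_pos_nonpos hu (fun h => absurd h ho) hq) hmem |>.not_gt
    (shiftedChord_leaf_pos_pos hv)

theorem pos_notMem_segment (hv : v ∉ l.spine) (hqv : q ≠ v) (hqu : q ≠ l.parent v) :
    l.pos v ∉ segment ℝ (l.pos (l.parent v)) (l.pos q) := by
  by_cases ho : l.owner q = l.parent v
  · obtain ⟨hq, hparent⟩ := parent_eq_of_owner_eq ho hqu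
    exact pos_notMem_segment_of_parent_eq hv hq hqv hparent
  by_cases hslot : l.slot q = l.start (l.parent v) + 2 * l.half (l.parent v)
  · refine pos_notMem_segment_of_slot_eq hv ?_ hslot
    by_contra hq
    have hdisj := l.disjoint _ (l.owner_mem q) _ (l.parent_mem v hv) ho
    rw [owner_of_notMem hq] at hdisj
    rw [slot_of_notMem hq] at hslot
    have hidx := l.idx_lt q hq
    omega
  · exact pos_notMem_segment_of_owner_ne hv ho hslot

theorem isUncrossed_parent (hv : v ∉ l.spine) : IsUncrossed l.pos v (l.parent v) :=
  isUncrossed_of_separating_line (leafTangent_pos_eq_zero hv) (leafTangent_parent_pos_pos hv)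
    (fun _ => leafTangent_pos_neg hv) fun _ => pos_notMem_segment hv

end

/-! ## The drawing of a block layout -/

variable {G S : SimpleGraph V}

theorem isStraightLineDrawing : IsStraightLineDrawing G l.pos := by
  refine ⟨l.pos_injective, fun a b v hab hva hvb hmem => ?_⟩
  by_cases hv : v ∈ l.spine
  · exact (apply_neg_of_mem_segment (slotChord_tangent_pos_neg hva.symm)
      (slotChord_tangent_pos_neg hvb.symm) hmem).ne (slotChord_tangent_pos_eq_zero hv)
  by_cases hau : a = l.parent v
  · subst hau
    exact pos_notMem_segment hv hvb.symm hab.ne' hmem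
  by_cases hbu : b = l.parent v
  · subst hbu
    rw [segment_symm] at hmem
    exact pos_notMem_segment hv hva.symm hau hmem
  · exact (apply_neg_of_mem_segment (leafTangent_pos_neg hv hva.symm hau)
      (leafTangent_pos_neg hv hvb.symm hbu) hmem).ne (leafTangent_pos_eq_zero hv)

theorem isCompatibleDrawing
    (hedge : ∀ a b, S.Adj a b → (a ∉ l.spine ∧ b = l.parent a) ∨ (b ∉ l.spine ∧ a = l.parent b) ∨
      (a ∈ l.spine ∧ b ∈ l.spine ∧ (l.start b = l.start a + 2 * l.half a ∨
        l.start a = l.start b + 2 * l.half b))) :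
    IsCompatibleDrawing G S l.pos := by
  refine ⟨l.isStraightLineDrawing, fun a b c d hab hcd => ?_⟩
  suffices IsUncrossed l.pos a b from this c d hcd.ne
  rcases hedge a b hab with ⟨ha, rfl⟩ | ⟨hb, rfl⟩ | ⟨ha, hb, h | h⟩
  · exact isUncrossed_parent ha
  · exact (isUncrossed_parent hb).symm
  · exact isUncrossed_of_slot_eq ha hb h
  · exact (isUncrossed_of_slot_eq hb ha h).symm

theorem cospherical_leaves (u : V) :
    EuclideanGeometry.Cospherical (l.pos '' {v | v ∉ l.spine ∧ l.parent v = u}) := by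
  have hzero : ∀ p ∈ l.pos '' {v | v ∉ l.spine ∧ l.parent v = u}, l.leafCirclePower u p = 0 := by
    rintro _ ⟨v, ⟨hv, rfl⟩, rfl⟩
    exact leafCirclePower_leaf_pos hv
  exact cospherical_of_circlePower_eq_zero hzero

theorem pos_mem_quadrant (v : V) :
    (-spineRadius l.n ≤ l.pos v 0 ∧ l.pos v 0 ≤ 0) ∧
      0 ≤ l.pos v 1 ∧ l.pos v 1 ≤ spineRadius l.n := by
  have hs := l.slot_cast_bounds v
  have hangle : 0 ≤ l.slot v * slotAngle l.n := mul_nonneg (Nat.cast_nonneg _) (slotAngle_pos _).le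
  have hangle' : l.slot v * slotAngle l.n ≤ Real.pi / 2 := mul_slotAngle_le_pi_div_two (by linarith)
  have hcos : 0 ≤ Real.cos (l.slot v * slotAngle l.n) :=
    Real.cos_nonneg_of_neg_pi_div_two_le_of_le (by linarith [Real.pi_pos]) hangle'
  have hsin : 0 ≤ Real.sin (l.slot v * slotAngle l.n) :=
    Real.sin_nonneg_of_nonneg_of_le_pi hangle (by linarith [Real.pi_pos])
  have hr := (l.spineRadius_mul_rad_pos v).le
  have hcos1 := mul_le_of_le_one_right hr (Real.cos_le_one (l.slot v * slotAngle l.n))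
  have hsin1 := mul_le_of_le_one_right hr (Real.sin_le_one (l.slot v * slotAngle l.n))
  have hle := l.spineRadius_mul_rad_le v
  rw [pos, polarPoint_zero, polarPoint_one]
  exact ⟨⟨by linarith, by linarith [mul_nonneg hr hcos]⟩, mul_nonneg hr hsin, by linarith⟩

theorem isQuarterCircleLayout (hspine : l.spine = spineSet S)
    (hparent : ∀ u v, IsLeafOf S v → S.Adj u v → l.parent v = u) :
    IsQuarterCircleLayout S l.pos := by
  have hleaf : ∀ v, IsLeafOf S v → v ∉ l.spine := fun v hv hmem => by
    rw [hspine] at hmem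
    exact hmem hv
  refine ⟨0, spineRadius l.n, spineRadius_pos _, fun u hu => ?_, fun v hv => ?_, fun u _ => ?_⟩
  · rw [← hspine] at hu
    obtain ⟨⟨-, hx⟩, hy, -⟩ := l.pos_mem_quadrant u
    exact ⟨by rw [dist_pos_zero, rad_of_mem hu, mul_one], hx, hy⟩
  · rw [dist_pos_zero]
    exact mul_lt_of_lt_one_right (spineRadius_pos _) (rad_lt_one (hleaf v hv))
  · refine (l.cospherical_leaves u).subset (Set.image_mono ?_)
    exact fun v ⟨hv, huv⟩ => ⟨hleaf v hv, hparent u v hv huv⟩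

theorem isQuarterCircleLayout_of_forall_isLeafOf (h : ∀ v, IsLeafOf S v) :
    IsQuarterCircleLayout S l.pos := by
  refine ⟨0, spineRadius l.n + 1, by linarith [spineRadius_pos l.n],
    fun u hu => absurd (h u) hu, fun v _ => ?_, fun u hu => absurd (h u) hu⟩
  rw [dist_pos_zero]
  linarith [l.spineRadius_mul_rad_le v]

end BlockLayout

/-! ## The area of a drawing -/

theorem extent_le {X : Set Plane} {i : Fin 2} {a b : ℝ} (hX : X.Nonempty)
    (h : ∀ p ∈ X, a ≤ p i ∧ p i ≤ b) : 0 ≤ extent X i ∧ extent X i ≤ b - a := by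
  have hne : ((fun p : Plane => p i) '' X).Nonempty := hX.image _
  have hlower : a ∈ lowerBounds ((fun p : Plane => p i) '' X) :=
    Set.forall_mem_image.2 fun p hp => (h p hp).1
  have hupper : b ∈ upperBounds ((fun p : Plane => p i) '' X) :=
    Set.forall_mem_image.2 fun p hp => (h p hp).2
  exact ⟨sub_nonneg.2 (csInf_le_csSup hne ⟨a, hlower⟩ ⟨b, hupper⟩),
    sub_le_sub (csSup_le hne hupper) (le_csInf hne hlower)⟩

section DrawingArea

variable {V : Type*} (G : SimpleGraph V) {pos : V → Plane}

theorem mem_Icc_of_mem_drawnPoints {i : Fin 2} {a b : ℝ} (h : ∀ v, a ≤ pos v i ∧ pos v i ≤ b)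
    {p : Plane} (hp : p ∈ drawnPoints G pos) : a ≤ p i ∧ p i ≤ b := by
  rcases hp with ⟨v, rfl⟩ | ⟨x, y, -, hp⟩
  · exact h v
  · exact ((convex_Icc a b).linear_preimage (EuclideanSpace.proj i).toLinearMap).segment_subset
      (h x) (h y) hp

theorem drawingArea_le [Nonempty V] {R : ℝ}
    (h : ∀ v, (-R ≤ pos v 0 ∧ pos v 0 ≤ 0) ∧ 0 ≤ pos v 1 ∧ pos v 1 ≤ R) :
    drawingArea G pos ≤ R ^ 2 := by
  have hne : (drawnPoints G pos).Nonempty := ⟨_, Or.inl ⟨Classical.arbitrary V, rfl⟩⟩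
  obtain ⟨hwidth, hwidth'⟩ := extent_le hne fun _ => mem_Icc_of_mem_drawnPoints G fun v => (h v).1
  obtain ⟨hheight, hheight'⟩ :=
    extent_le hne fun _ => mem_Icc_of_mem_drawnPoints G fun v => (h v).2
  rw [zero_sub, neg_neg] at hwidth'
  rw [sub_zero] at hheight'
  rw [drawingArea, sq]
  exact mul_le_mul hwidth' hheight' hheight (hwidth.trans hwidth')

end DrawingArea

/-! ## Reasoning about programs -/

-- Names of arrays are notations, so that `simp` and `decide` see the literals.
local notation "sizeArr" => 0
local notation "fstEndArr" => 3
local notation "sndEndArr" => 4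
local notation "degreeArr" => 5
local notation "flagArr" => 6
local notation "labelArr" => 7
local notation "spineDegreeArr" => 8
local notation "neighborArr" => 9
local notation "counterArr" => 10
local notation "leafCountArr" => 11
local notation "leafRankArr" => 12
local notation "currentArr" => 13
local notation "startArr" => 14
local notation "slotArr" => 15
local notation "lengthArr" => 16
local notation "previousArr" => 17
local notation "nextArr" => 18
local notation "usedSlotsArr" => 19
local notation "radiusArr" => 2

local infixr:60 ";;" => RealRAM.Program.seq

namespace RealRAM

theorem State.storeNat_nat (s : State) (a i k b j : ℕ) :
    (s.storeNat a i k).nat b j = if b = a ∧ j = i then k else s.nat b j := by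
  by_cases hb : b = a
  · subst hb
    simp [State.storeNat, Function.update_apply]
  · simp [State.storeNat, hb]

theorem State.storeNat_nat_of_ne (s : State) {a b : ℕ} (h : b ≠ a) (i k : ℕ) :
    (s.storeNat a i k).nat b = s.nat b :=
  Function.update_of_ne h _ _

@[simp] theorem State.storeNat_real (s : State) (a i k : ℕ) :
    (s.storeNat a i k).real = s.real := rfl

theorem State.storeReal_real (s : State) (a i : ℕ) (x : ℝ) (b j : ℕ) :
    (s.storeReal a i x).real b j = if b = a ∧ j = i then x else s.real b j := by
  by_cases hb : b = a
  · subst hb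
    simp [State.storeReal, Function.update_apply]
  · simp [State.storeReal, hb]

@[simp] theorem State.storeReal_nat (s : State) (a i : ℕ) (x : ℝ) :
    (s.storeReal a i x).nat = s.nat := rfl

namespace Program

/-- Programs without loops. -/
def LoopFree : Program → Prop
  | skip => True
  | setNat _ _ _ => True
  | setReal _ _ _ => True
  | seq p q => p.LoopFree ∧ q.LoopFree
  | ite _ p q => p.LoopFree ∧ q.LoopFree
  | .while _ _ => False

/-- The arrays of natural numbers that a program may store to. -/
def writes : Program → List ℕ
  | skip => []
  | setNat a _ _ => [a]
  | setReal _ _ _ => []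
  | seq p q => p.writes ++ q.writes
  | ite _ p q => p.writes ++ q.writes
  | .while _ p => p.writes

/-- A bound for the number of steps of a program if the body of each loop is executed at most
once. -/
def maxCost : Program → ℕ
  | skip => 1
  | setNat _ i e => i.cost + e.cost + 1
  | setReal _ i x => i.cost + x.cost + 1
  | seq p q => p.maxCost + q.maxCost
  | ite b p q => b.cost + (p.maxCost + q.maxCost)
  | .while b p => b.cost + p.maxCost

open Classical in
/-- The final state of a loop-free program; the value at a loop is irrelevant. -/
noncomputable def exec : Program → State → State
  | skip, s => s
  | setNat a i e, s => s.storeNat a (i.value s) (e.value s)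
  | setReal a i x, s => s.storeReal a (i.value s) (x.value s)
  | seq p q, s => q.exec (p.exec s)
  | ite b p q, s => if b.Holds s then p.exec s else q.exec s
  | .while _ _, s => s

theorem LoopFree.exists_run_exec : ∀ {p : Program}, p.LoopFree → ∀ s : State,
    ∃ t ≤ p.maxCost, Run p s t (p.exec s)
  | skip, _, s => ⟨1, le_rfl, .skip s⟩
  | setNat a i e, _, s => ⟨_, le_rfl, .setNat s a i e⟩
  | setReal a i x, _, s => ⟨_, le_rfl, .setReal s a i x⟩
  | seq _ _, h, s => by
      obtain ⟨t, ht, hp⟩ := h.1.exists_run_exec s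
      obtain ⟨t', ht', hq⟩ := h.2.exists_run_exec (exec _ s)
      exact ⟨t + t', Nat.add_le_add ht ht', .seq hp hq⟩
  | ite b _ _, h, s => by
      by_cases hb : b.Holds s
      · obtain ⟨t, ht, hp⟩ := h.1.exists_run_exec s
        refine ⟨b.cost + t, Nat.add_le_add_left (ht.trans (Nat.le_add_right _ _)) _, ?_⟩
        rw [exec, if_pos hb]
        exact .ite_true hb hp
      · obtain ⟨t, ht, hq⟩ := h.2.exists_run_exec s
        refine ⟨b.cost + t, Nat.add_le_add_left (ht.trans (Nat.le_add_left _ _)) _, ?_⟩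
        rw [exec, if_neg hb]
        exact .ite_false hb hq

end Program

theorem Run.nat_eq_of_notMem {p : Program} {s s' : State} {t : ℕ} (h : Run p s t s') {a : ℕ}
    (ha : a ∉ p.writes) : s'.nat a = s.nat a := by
  induction h with
  | skip | setReal | while_false => rfl
  | setNat s b i e => exact s.storeNat_nat_of_ne (by simpa [Program.writes] using ha) _ _
  | seq _ _ ihp ihq =>
    simp only [Program.writes, List.mem_append, not_or] at ha
    exact (ihq ha.2).trans (ihp ha.1)
  | ite_true _ _ ih =>
    simp only [Program.writes, List.mem_append, not_or] at ha
    exact ih ha.1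
  | ite_false _ _ ih =>
    simp only [Program.writes, List.mem_append, not_or] at ha
    exact ih ha.2
  | while_true _ _ _ ihp ihw => exact (ihw ha).trans (ihp ha)

/-- The memory `s` agrees with `s₀` on the arrays of natural numbers that `p` does not store to. -/
def Frame (p : Program) (s₀ s : State) : Prop := ∀ a ∉ p.writes, s.nat a = s₀.nat a

theorem Frame.nat_eq {p : Program} {s₀ s : State} (h : Frame p s₀ s) {l : List ℕ}
    (hl : ∀ a ∈ l, a ∉ p.writes) : ∀ a ∈ l, s.nat a = s₀.nat a :=
  fun a ha => h a (hl a ha)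

/-- The total correctness triple: program `p`, started in state `s`, halts in a state with
property `Q`, after a number of steps that is sufficient if `p` consists of consecutive loops with
at most `N` rounds. -/
def Runs (N : ℕ) (p : Program) (s : State) (Q : State → Prop) : Prop :=
  ∃ t s', Run p s t s' ∧ t ≤ p.maxCost * N ∧ Q s'

theorem Runs.mono {N : ℕ} {p : Program} {s : State} {Q Q' : State → Prop} (h : Runs N p s Q)
    (hQ : ∀ s', Frame p s s' → Q s' → Q' s') : Runs N p s Q' := by
  obtain ⟨t, s', hrun, ht, hs'⟩ := h
  exact ⟨t, s', hrun, ht, hQ s' (fun _ => hrun.nat_eq_of_notMem) hs'⟩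

theorem Runs.seq {N : ℕ} {p q : Program} {s : State} {Q Q' : State → Prop} (hp : Runs N p s Q)
    (hq : ∀ s', Frame p s s' → Q s' → Runs N q s' Q') : Runs N (p ;; q) s Q' := by
  obtain ⟨t, s', hrun, ht, hs'⟩ := hp
  obtain ⟨t', s'', hrun', ht', hs''⟩ := hq s' (fun _ => hrun.nat_eq_of_notMem) hs'
  exact ⟨t + t', s'', hrun.seq hrun', by rw [Program.maxCost, add_mul]; exact add_le_add ht ht',
    hs''⟩

/-- The loop counter, a scalar variable. -/
def counter : NatExpr := .load counterArr (.const 0)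

/-- A loop in which the counter runs from zero to the value of cell `j` of array `c`. -/
def forLoop (c j : ℕ) (body : Program) : Program :=
  .setNat counterArr (.const 0) (.const 0) ;;
    .while (.natLt counter (.load c (.const j)))
      (body ;; .setNat counterArr (.const 0) (.add counter (.const 1)))

theorem exists_run_while {c j N : ℕ} {body : Program} (hfree : body.LoopFree)
    (hcounter : counterArr ∉ body.writes) (Inv : ℕ → State → Prop)
    (hbound : ∀ i s, Inv i s → s.nat c j = N)
    (hstep : ∀ i s, i < N → s.nat counterArr 0 = i → Inv i s →
      Inv (i + 1) ((body.exec s).storeNat counterArr 0 (i + 1)))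
    (d : ℕ) {i : ℕ} {s : State} (hi : i + d = N) (hs : s.nat counterArr 0 = i) (hinv : Inv i s) :
    ∃ t s', Run (.while (.natLt counter (.load c (.const j)))
        (body ;; .setNat counterArr (.const 0) (.add counter (.const 1)))) s t s' ∧
      t ≤ (body.maxCost + 11) * d + 5 ∧ Inv N s' := by
  induction d generalizing i s with
  | zero =>
    refine ⟨_, s, .while_false ?_, by simp [Test.cost, counter, NatExpr.cost], hi ▸ hinv⟩
    simp only [Test.Holds, counter, NatExpr.value, hs, hbound i s hinv]
    omega
  | succ d ih =>
    obtain ⟨t, ht, hrun⟩ := hfree.exists_run_exec s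
    have hsame : (body.exec s).nat counterArr 0 = i := by rw [hrun.nat_eq_of_notMem hcounter, hs]
    have hround := hrun.seq
      (.setNat (body.exec s) counterArr (.const 0) (.add counter (.const 1)))
    simp only [counter, NatExpr.value, hsame] at hround
    obtain ⟨t', s', hrun', ht', hs'⟩ := ih (s := (body.exec s).storeNat counterArr 0 (i + 1))
      (by omega) (by simp [State.storeNat_nat]) (hstep i s (by omega) hs hinv)
    refine ⟨_, s', .while_true ?_ hround hrun', ?_, hs'⟩
    · simp only [Test.Holds, counter, NatExpr.value, hs, hbound i s hinv]
      omega
    · simp only [Test.cost, counter, NatExpr.cost, mul_add_one] at ht' ⊢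
      omega

theorem runs_forLoop {c j N : ℕ} {body : Program} (hfree : body.LoopFree)
    (hcounter : counterArr ∉ body.writes) (hc : c ∉ (forLoop c j body).writes) {s₀ : State}
    (hN : s₀.nat c j < N) (Inv : ℕ → State → Prop) (h0 : Inv 0 (s₀.storeNat counterArr 0 0))
    (hstep : ∀ i s, i < s₀.nat c j → s.nat counterArr 0 = i → Frame (forLoop c j body) s₀ s →
      Inv i s → Inv (i + 1) ((body.exec s).storeNat counterArr 0 (i + 1))) :
    Runs N (forLoop c j body) s₀ (Inv (s₀.nat c j)) := by
  have hwrites {a : ℕ} (ha : a ∉ (forLoop c j body).writes) :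
      a ≠ counterArr ∧ a ∉ body.writes := by
    simp only [forLoop, Program.writes, List.mem_append, List.mem_singleton, not_or] at ha
    exact ⟨ha.1, ha.2.1⟩
  have hloop := exists_run_while hfree hcounter (c := c) (j := j)
    (fun i s => Frame (forLoop c j body) s₀ s ∧ Inv i s) (fun i s h => by rw [h.1 c hc])
    (fun i s hi hs h => ⟨fun a ha => by
      obtain ⟨t, -, hrun⟩ := hfree.exists_run_exec s
      rw [State.storeNat_nat_of_ne _ (hwrites ha).1, hrun.nat_eq_of_notMem (hwrites ha).2,
        h.1 a ha],
      hstep i s hi hs h.1 h.2⟩)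
    (s₀.nat c j) (s := s₀.storeNat counterArr 0 0) (zero_add _) (by simp [State.storeNat_nat])
    ⟨fun a ha => s₀.storeNat_nat_of_ne (hwrites ha).1 _ _, h0⟩
  obtain ⟨t, s, hrun, ht, -, hs⟩ := hloop
  refine ⟨_, s, .seq (.setNat s₀ counterArr (.const 0) (.const 0)) hrun, ?_, hs⟩
  refine le_trans ?_ (Nat.mul_le_mul_left _ hN)
  simp only [forLoop, Program.maxCost, Test.cost, counter, NatExpr.cost, Nat.mul_succ]
  linarith [Nat.mul_le_mul_right (s₀.nat c j)
    (show body.maxCost + 11 ≤ 3 + (5 + (body.maxCost + 6)) by omega)]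

end RealRAM

/-! ## The spine of a caterpillar -/

/-- A decomposition of the graph `S` into a path `u 0, …, u (k - 1)` with vertex set `spine` and
leaves: each other vertex `v` is adjacent to the vertex `parent v` of the path and to no other
vertex. -/
structure IsSpinePath {V : Type*} (S : SimpleGraph V) (spine : Set V) (parent : V → V) (k : ℕ)
    (u : ℕ → V) : Prop where
  length_pos : 0 < k
  bijOn : Set.BijOn u (Set.Iio k) spine
  adj_iff : ∀ i < k, ∀ j < k, S.Adj (u i) (u j) ↔ i + 1 = j ∨ j + 1 = i
  parent_mem : ∀ v ∉ spine, parent v ∈ spine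
  adj_iff_eq_parent : ∀ v ∉ spine, ∀ w, S.Adj v w ↔ w = parent v

namespace IsSpinePath

variable {V : Type*} {S : SimpleGraph V} {spine : Set V} {parent : V → V} {k : ℕ} {u : ℕ → V}

theorem reverse (h : IsSpinePath S spine parent k u) :
    IsSpinePath S spine parent k fun i => u (k - 1 - i) where
  length_pos := h.length_pos
  bijOn := h.bijOn.comp (Set.BijOn.mk (fun i (hi : i < k) => show k - 1 - i < k by omega)
    (fun i (hi : i < k) j (hj : j < k) (hij : k - 1 - i = k - 1 - j) => by omega)
    fun i (hi : i < k) => ⟨k - 1 - i, show k - 1 - i < k by omega, Nat.sub_sub_self (by omega)⟩)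
  adj_iff i hi j hj := by
    rw [h.adj_iff _ (by omega) _ (by omega)]
    omega
  parent_mem := h.parent_mem
  adj_iff_eq_parent := h.adj_iff_eq_parent

theorem ncard_spine (h : IsSpinePath S spine parent k u) : spine.ncard = k := by
  rw [← h.bijOn.image_eq, h.bijOn.injOn.ncard_image, Set.ncard_Iio_nat]

theorem mem (h : IsSpinePath S spine parent k u) {i : ℕ} (hi : i < k) : u i ∈ spine :=
  h.bijOn.mapsTo hi

theorem exists_eq (h : IsSpinePath S spine parent k u) {v : V} (hv : v ∈ spine) :
    ∃ i < k, u i = v :=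
  h.bijOn.surjOn hv

theorem sum_spine_neighbors_of_notMem [Fintype V] (h : IsSpinePath S spine parent k u) {v : V}
    (hv : v ∉ spine) (f : V → ℕ) :
    ∑ w, (S.neighborSet v ∩ spine).indicator f w = f (parent v) := by
  have hset : S.neighborSet v ∩ spine = {parent v} := by
    ext w
    simp only [Set.mem_inter_iff, SimpleGraph.mem_neighborSet, h.adj_iff_eq_parent v hv,
      Set.mem_singleton_iff, and_iff_left_iff_imp]
    rintro rfl
    exact h.parent_mem v hv
  classical simp [hset, Set.indicator_apply]

theorem sum_spine_neighbors_apply [Fintype V] (h : IsSpinePath S spine parent k u) {i : ℕ}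
    (hi : i < k) (f : V → ℕ) :
    ∑ w, (S.neighborSet (u i) ∩ spine).indicator f w =
      (if i + 1 < k then f (u (i + 1)) else 0) + if i = 0 then 0 else f (u (i - 1)) := by
  classical
  calc ∑ w, (S.neighborSet (u i) ∩ spine).indicator f w
      = ∑ w with w ∈ spine, (S.neighborSet (u i)).indicator f w := by
        rw [Finset.sum_filter]
        exact Finset.sum_congr rfl fun w _ => by simp [Set.indicator_apply, and_comm, ite_and]
    _ = ∑ j ∈ Finset.range k, (S.neighborSet (u i)).indicator f (u j) :=
        (Finset.sum_nbij u (by simpa using fun j hj => h.mem hj)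
          (by simpa [Set.Iio_def] using h.bijOn.injOn)
          (by simpa [Set.Iio_def] using h.bijOn.surjOn) fun _ _ => rfl).symm
    _ = ∑ j ∈ Finset.range k, ((if i + 1 = j then f (u j) else 0) +
          if i - 1 = j then if i = 0 then 0 else f (u j) else 0) := by
        refine Finset.sum_congr rfl fun j hj => ?_
        simp only [Set.indicator_apply, SimpleGraph.mem_neighborSet,
          h.adj_iff i hi j (Finset.mem_range.1 hj)]
        split_ifs <;> omega
    _ = _ := by
        rw [Finset.sum_add_distrib, Finset.sum_ite_eq, Finset.sum_ite_eq]
        simp only [Finset.mem_range, show i - 1 < k by omega, if_true]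

theorem exists_reordering (h : IsSpinePath S spine parent k u) [Fintype V] {v : V} (hv : v ∈ spine)
    (hend : ∑ w, (S.neighborSet v ∩ spine).indicator (fun _ => 1) w < 2) :
    ∃ u' : ℕ → V, u' 0 = v ∧ IsSpinePath S spine parent k u' := by
  obtain ⟨i, hi, rfl⟩ := h.exists_eq hv
  rw [h.sum_spine_neighbors_apply hi] at hend
  obtain rfl | hlast : i = 0 ∨ i + 1 = k := by
    split_ifs at hend <;> omega
  · exact ⟨u, rfl, h⟩
  · exact ⟨fun j => u (k - 1 - j), congrArg u (by omega), h.reverse⟩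

end IsSpinePath

/-! ### Leaf counts and the layout of a spine path -/

/-- The number of leaves attached to the spine vertex `u`. -/
noncomputable def leafCount {V : Type*} (spine : Set V) (parent : V → V) (u : V) : ℕ :=
  {w | w ∉ spine ∧ parent w = u}.ncard

/-- The position of the leaf `v` among the leaves with the same parent, counted from zero. -/
noncomputable def leafRank {V : Type*} [LT V] (spine : Set V) (parent : V → V) (v : V) : ℕ :=
  {w | w < v ∧ w ∉ spine ∧ parent w = parent v}.ncard

/-- The first slot of the `i`-th block on the quarter circle, when the spine vertex `u i` receives a
block of `2 * (leafCount spine parent (u i) + 1)` slots and the blocks follow one another. -/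
noncomputable def blockStart {V : Type*} (spine : Set V) (parent : V → V) (u : ℕ → V) (i : ℕ) : ℕ :=
  1 + ∑ j ∈ Finset.range i, 2 * (leafCount spine parent (u j) + 1)

section

variable {V : Type*} {spine : Set V} {parent : V → V}

theorem blockStart_succ (u : ℕ → V) (i : ℕ) :
    blockStart spine parent u (i + 1) =
      blockStart spine parent u i + 2 * (leafCount spine parent (u i) + 1) := by
  rw [blockStart, Finset.sum_range_succ, ← add_assoc, ← blockStart]

theorem monotone_blockStart (u : ℕ → V) : Monotone (blockStart spine parent u) :=
  monotone_nat_of_le_succ fun i => by rw [blockStart_succ]; exact Nat.le_add_right _ _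

theorem blockStart_add_le (u : ℕ → V) {i j : ℕ} (hij : i < j) :
    blockStart spine parent u i + 2 * (leafCount spine parent (u i) + 1) ≤
      blockStart spine parent u j := by
  rw [← blockStart_succ]
  exact monotone_blockStart u hij

theorem leafRank_lt_leafRank [LinearOrder V] [Finite V] {v w : V} (hv : v ∉ spine)
    (hvw : parent v = parent w) (hlt : v < w) :
    leafRank spine parent v < leafRank spine parent w :=
  Set.ncard_lt_ncard <| (Set.ssubset_iff_of_subset fun _ hx =>
    And.intro (hx.1.trans hlt) ⟨hx.2.1, hx.2.2.trans hvw⟩).2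
    ⟨v, ⟨hlt, hv, hvw⟩, fun h => lt_irrefl v h.1⟩

theorem leafRank_inj [LinearOrder V] [Finite V] {v w : V} (hv : v ∉ spine) (hw : w ∉ spine)
    (hvw : parent v = parent w) (h : leafRank spine parent v = leafRank spine parent w) :
    v = w := by
  rcases lt_trichotomy v w with hlt | rfl | hlt
  · exact absurd h (leafRank_lt_leafRank hv hvw hlt).ne
  · rfl
  · exact absurd h (leafRank_lt_leafRank hw hvw.symm hlt).ne'

theorem leafRank_lt_leafCount [Preorder V] [Finite V] {v : V} (hv : v ∉ spine) :
    leafRank spine parent v < leafCount spine parent (parent v) :=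
  Set.ncard_lt_ncard <| (Set.ssubset_iff_of_subset fun _ hx => hx.2).2
    ⟨v, ⟨hv, rfl⟩, fun h => lt_irrefl v h.1⟩

end

namespace IsSpinePath

variable {V : Type*} {S : SimpleGraph V} {spine : Set V} {parent : V → V} {k : ℕ} {u : ℕ → V}

theorem leafCount_lt_card [Finite V] (h : IsSpinePath S spine parent k u) (v : V) :
    leafCount spine parent v < Nat.card V := by
  rw [← Set.ncard_univ]
  refine Set.ncard_lt_ncard <| (Set.ssubset_iff_of_subset (Set.subset_univ _)).2
    ⟨v, Set.mem_univ v, fun hv => hv.1 ?_⟩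
  simpa only [hv.2] using h.parent_mem v hv.1

theorem sum_leafCount [Finite V] (h : IsSpinePath S spine parent k u) :
    ∑ i ∈ Finset.range k, leafCount spine parent (u i) = spineᶜ.ncard := by
  classical
  have := Fintype.ofFinite V
  calc ∑ i ∈ Finset.range k, leafCount spine parent (u i)
      = ∑ v ∈ spine.toFinset, leafCount spine parent v :=
        Finset.sum_nbij u (by simpa using fun j hj => h.mem hj)
          (by simpa [Set.Iio_def] using h.bijOn.injOn)
          (by simpa [Set.Iio_def] using h.bijOn.surjOn) fun _ _ => rfl
    _ = ∑ v ∈ spine.toFinset, (spineᶜ.toFinset.filter (parent · = v)).card := by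
        refine Finset.sum_congr rfl fun v _ => ?_
        rw [leafCount, Set.ncard_eq_toFinset_card']
        congr 1
        ext w
        simp
    _ = spineᶜ.toFinset.card := (Finset.card_eq_sum_card_fiberwise fun v hv => by
        simpa using h.parent_mem v (by simpa using hv)).symm
    _ = spineᶜ.ncard := (Set.ncard_eq_toFinset_card' _).symm

theorem blockStart_length [Finite V] (h : IsSpinePath S spine parent k u) :
    blockStart spine parent u k = 2 * Nat.card V + 1 := by
  rw [blockStart, ← Finset.mul_sum, Finset.sum_add_distrib, h.sum_leafCount,
    ← Set.ncard_add_ncard_compl spine, h.ncard_spine]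
  simp [add_comm]

theorem invFunOn_apply (h : IsSpinePath S spine parent k u) {i : ℕ} (hi : i < k) :
    Function.invFunOn u (Set.Iio k) (u i) = i :=
  h.bijOn.invOn_invFunOn.1 hi

/-- The block layout in which the path is drawn from left to right and the leaves of each spine
vertex are ordered as vertices. -/
noncomputable def layout [LinearOrder V] [Finite V] (h : IsSpinePath S spine parent k u) :
    BlockLayout V where
  n := Nat.card V
  spine := spine
  parent := parent
  start v := blockStart spine parent u (Function.invFunOn u (Set.Iio k) v)
  half v := leafCount spine parent v + 1
  idx := leafRank spine parent
  one_le_half _ := Nat.le_add_left _ _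
  half_le := h.leafCount_lt_card
  start_pos _ _ := Nat.le_add_right _ _
  start_le v hv := by
    obtain ⟨i, hi, rfl⟩ := h.exists_eq hv
    rw [h.invFunOn_apply hi, ← h.blockStart_length]
    exact blockStart_add_le u hi
  disjoint v hv w hw hvw := by
    obtain ⟨i, hi, rfl⟩ := h.exists_eq hv
    obtain ⟨j, hj, rfl⟩ := h.exists_eq hw
    rw [h.invFunOn_apply hi, h.invFunOn_apply hj]
    exact (ne_of_apply_ne u hvw).lt_or_gt.imp (blockStart_add_le u) (blockStart_add_le u)
  parent_mem := h.parent_mem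
  idx_lt v hv := Nat.add_lt_add_right (leafRank_lt_leafCount hv) 1
  idx_inj _ hv _ hw := leafRank_inj hv hw

theorem layout_start [LinearOrder V] [Finite V] (h : IsSpinePath S spine parent k u) {i : ℕ}
    (hi : i < k) : h.layout.start (u i) = blockStart spine parent u i :=
  congrArg (blockStart spine parent u) (h.invFunOn_apply hi)

theorem layout_adj [LinearOrder V] [Finite V] (h : IsSpinePath S spine parent k u) (a b : V)
    (hab : S.Adj a b) :
    (a ∉ h.layout.spine ∧ b = h.layout.parent a) ∨ (b ∉ h.layout.spine ∧ a = h.layout.parent b) ∨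
      (a ∈ h.layout.spine ∧ b ∈ h.layout.spine ∧
        (h.layout.start b = h.layout.start a + 2 * h.layout.half a ∨
          h.layout.start a = h.layout.start b + 2 * h.layout.half b)) := by
  by_cases ha : a ∈ spine
  · by_cases hb : b ∈ spine
    · refine .inr (.inr ⟨ha, hb, ?_⟩)
      obtain ⟨i, hi, rfl⟩ := h.exists_eq ha
      obtain ⟨j, hj, rfl⟩ := h.exists_eq hb
      rw [h.layout_start hi, h.layout_start hj]
      obtain rfl | rfl := (h.adj_iff i hi j hj).1 hab
      · exact .inl (blockStart_succ u i)
      · exact .inr (blockStart_succ u j)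
    · exact .inr (.inl ⟨hb, (h.adj_iff_eq_parent b hb a).1 hab.symm⟩)
  · exact .inl ⟨ha, (h.adj_iff_eq_parent a ha b).1 hab⟩

end IsSpinePath

/-! ### Caterpillars -/

section

variable {V : Type*} {S : SimpleGraph V}

theorem eq_or_eq_of_isLeafOf_of_adj (hS : S.Connected) {v w : V} (hv : IsLeafOf S v)
    (hw : IsLeafOf S w) (h : S.Adj v w) (x : V) : x = v ∨ x = w := by
  have hwalk {a b : V} (p : S.Walk a b) : (a = v ∨ a = w) → (b = v ∨ b = w) := by
    induction p with
    | nil => exact id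
    | cons hab _ ih =>
      rintro (rfl | rfl)
      · exact ih (.inr (hv.unique hab h))
      · exact ih (.inl (hw.unique hab h.symm))
  obtain ⟨p⟩ := hS.preconnected v x
  exact hwalk p (.inl rfl)

theorem isSpinePath_singleton (hS : S.Connected) (hleaf : ∀ v, IsLeafOf S v) (r : V) :
    IsSpinePath S {r} (fun _ => r) 1 fun _ => r where
  length_pos := one_pos
  bijOn := by simp [Set.BijOn, Set.MapsTo, Set.InjOn, Set.SurjOn]
  adj_iff i hi j hj := by
    simp only [SimpleGraph.irrefl, false_iff]
    omega
  parent_mem _ _ := rfl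
  adj_iff_eq_parent v hv w := by
    obtain ⟨x, hvx, hx⟩ := id (hleaf v)
    obtain rfl : r = x := (eq_or_eq_of_isLeafOf_of_adj hS (hleaf v) (hleaf x) hvx r).resolve_left
      (Ne.symm hv)
    exact ⟨hx w, fun h => h ▸ hvx⟩

theorem IsCaterpillar.exists_isSpinePath_spineSet (hS : IsCaterpillar S) {v₀ : V}
    (hv₀ : ¬ IsLeafOf S v₀) : ∃ parent k u, IsSpinePath S (spineSet S) parent k u := by
  obtain ⟨hT, k, ⟨e⟩⟩ := hS
  have hparent (v : V) : ∃ p, v ∉ spineSet S → p ∈ spineSet S ∧ ∀ w, S.Adj v w ↔ w = p := by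
    by_cases hv : v ∈ spineSet S
    · exact ⟨v, fun h => absurd hv h⟩
    · have hv : IsLeafOf S v := not_not.1 hv
      obtain ⟨p, hvp, hp⟩ := id hv
      refine ⟨p, fun _ => ⟨fun hleaf => ?_, fun w => ⟨hp w, fun h => h ▸ hvp⟩⟩⟩
      obtain rfl | rfl := eq_or_eq_of_isLeafOf_of_adj hT.connected hv hleaf hvp v₀
      exacts [hv₀ hv, hv₀ hleaf]
  choose parent hparent using hparent
  obtain ⟨u, hu⟩ : ∃ u : ℕ → V, ∀ i (hi : i < k), u i = e.symm ⟨i, hi⟩ :=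
    ⟨fun i => if h : i < k then e.symm ⟨i, h⟩ else v₀, fun i hi => dif_pos hi⟩
  refine ⟨parent, k, u, Fin.pos (e ⟨v₀, hv₀⟩), ⟨?_, ?_, ?_⟩, ?_, fun v hv => (hparent v hv).1,
    fun v hv => (hparent v hv).2⟩
  · intro i hi
    rw [hu i hi]
    exact (e.symm ⟨i, hi⟩).2
  · intro i hi j hj hij
    rw [hu i hi, hu j hj] at hij
    exact congrArg Fin.val (e.symm.injective (Subtype.ext hij))
  · intro v hv
    exact ⟨e ⟨v, hv⟩, (e ⟨v, hv⟩).2, by simp [hu]⟩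
  · intro i hi j hj
    rw [hu i hi, hu j hj]
    exact (e.symm.map_adj_iff (v := ⟨i, hi⟩) (w := ⟨j, hj⟩)).trans SimpleGraph.pathGraph_adj

end

/-- The spine of a caterpillar with vertices `0, …, n - 1`, except that for a single edge, where
all vertices are leaves, the vertex `0` is taken as its spine; `n + v ≤ 2` holds for a leaf `v` only
in this case. -/
def markedSpine {n : ℕ} (S : SimpleGraph (Fin n)) : Set (Fin n) :=
  {v | ¬ IsLeafOf S v ∨ n + v ≤ 2}

section

variable {n : ℕ} {S : SimpleGraph (Fin n)}

theorem isLeafOf_of_eq_two (hS : S.Connected) (hn : n = 2) (v : Fin n) : IsLeafOf S v := by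
  have : Nontrivial (Fin n) := Fin.nontrivial_iff_two_le.2 hn.ge
  obtain ⟨w, hw⟩ := hS.preconnected.exists_adj_of_nontrivial v
  refine ⟨w, hw, fun x hx => Fin.ext ?_⟩
  have := Fin.val_ne_of_ne hw.ne
  have := Fin.val_ne_of_ne hx.ne
  omega

theorem markedSpine_eq_spineSet (hS : S.Connected) {v₀ : Fin n} (hv₀ : ¬ IsLeafOf S v₀) :
    markedSpine S = spineSet S := by
  have hn : n ≠ 2 := fun hn => hv₀ (isLeafOf_of_eq_two hS hn v₀)
  ext v
  refine or_iff_left_of_imp fun hv ⟨w, hw, _⟩ => hw.ne (Fin.ext ?_)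
  omega

theorem IsCaterpillar.exists_isSpinePath (hS : IsCaterpillar S) :
    ∃ parent k u, IsSpinePath S (markedSpine S) parent k u := by
  have hconn := hS.1.connected
  by_cases hleaf : ∀ v, IsLeafOf S v
  · obtain ⟨v⟩ := hconn.nonempty
    obtain ⟨w, hvw, -⟩ := id (hleaf v)
    have hn : n = 2 := by
      have huniv : (Finset.univ : Finset (Fin n)) = {v, w} := Finset.ext fun x => by
        simpa using eq_or_eq_of_isLeafOf_of_adj hconn (hleaf v) (hleaf w) hvw x
      rw [← Finset.card_fin n, huniv, Finset.card_pair hvw.ne]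
    have hmarked : markedSpine S = {⟨0, by omega⟩} := by
      ext x
      simp only [markedSpine, hleaf, not_true, false_or, Set.mem_ofPred_eq,
        Set.mem_singleton_iff, Fin.ext_iff]
      omega
    exact hmarked ▸ ⟨_, _, _, isSpinePath_singleton hconn hleaf _⟩
  · obtain ⟨v₀, hv₀⟩ := not_forall.1 hleaf
    exact markedSpine_eq_spineSet hconn hv₀ ▸ hS.exists_isSpinePath_spineSet hv₀

theorem IsSpinePath.isQuarterCircleLayout {parent : Fin n → Fin n} {k : ℕ} {u : ℕ → Fin n}
    (h : IsSpinePath S (markedSpine S) parent k u) (hS : S.Connected) :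
    IsQuarterCircleLayout S h.layout.pos := by
  by_cases hleaf : ∀ v, IsLeafOf S v
  · exact h.layout.isQuarterCircleLayout_of_forall_isLeafOf hleaf
  · obtain ⟨v₀, hv₀⟩ := not_forall.1 hleaf
    have hspine := markedSpine_eq_spineSet hS hv₀
    refine h.layout.isQuarterCircleLayout hspine fun v w hw hvw => ?_
    exact ((h.adj_iff_eq_parent w (hspine ▸ not_not.2 hw) v).1 hvw.symm).symm

end

/-! ## Edge lists -/

section

variable {n : ℕ} {S : SimpleGraph (Fin n)} {W : List (Fin n × Fin n)}

/-- What the edge `e` contributes to the sum of `f` over the neighbours of `v`. -/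
def edgeTerm (f : Fin n → ℕ) (v : Fin n) (e : Fin n × Fin n) : ℕ :=
  (if e.1 = v then f e.2 else 0) + if e.2 = v then f e.1 else 0

theorem edgeTerm_eq_sum (f : Fin n → ℕ) (v : Fin n) {e : Fin n × Fin n} (he : e.1 ≠ e.2) :
    edgeTerm f v e = ∑ w, if s(e.1, e.2) = s(v, w) then f w else 0 := by
  have hterm (w : Fin n) : (if s(e.1, e.2) = s(v, w) then f w else 0) =
      (if e.2 = w then if e.1 = v then f w else 0 else 0) +
        if e.1 = w then if e.2 = v then f w else 0 else 0 := by
    simp only [Sym2.eq_iff]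
    grind
  simp only [hterm, Finset.sum_add_distrib, Finset.sum_ite_eq, Finset.mem_univ, if_true, edgeTerm]

theorem IsEdgeList.sum_edgeTerm (hW : IsEdgeList S W) (f : Fin n → ℕ) (v : Fin n) :
    (W.map (edgeTerm f v)).sum = ∑ w, (S.neighborSet v).indicator f w := by
  classical
  calc (W.map (edgeTerm f v)).sum
      = ((W.map fun e => s(e.1, e.2)).map
          fun z => ∑ w, if z = s(v, w) then f w else 0).sum := by
        rw [List.map_map]
        exact congrArg List.sum <| List.map_congr_left fun e he =>
          edgeTerm_eq_sum f v ((hW.2 e.1 e.2).1 (List.mem_map_of_mem he)).ne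
    _ = ∑ w, ∑ z ∈ (W.map fun e => s(e.1, e.2)).toFinset, if z = s(v, w) then f w else 0 := by
        rw [← List.sum_toFinset _ hW.1, Finset.sum_comm]
    _ = ∑ w, (S.neighborSet v).indicator f w := by
        refine Finset.sum_congr rfl fun w _ => ?_
        simp only [Finset.sum_ite_eq', List.mem_toFinset, hW.2, Set.indicator_apply,
          SimpleGraph.mem_neighborSet]

theorem IsEdgeList.length_eq_ncard (hW : IsEdgeList S W) : W.length = S.edgeSet.ncard := by
  classical
  rw [← List.length_map (fun e => s(e.1, e.2)), ← List.toFinset_card_of_nodup hW.1,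
    ← Set.ncard_coe_finset]
  congr 1
  ext z
  induction z using Sym2.ind with
  | _ a b => simpa using hW.2 a b

theorem IsEdgeList.length_add_one (hW : IsEdgeList S W) (hS : S.IsTree) : W.length + 1 = n := by
  rw [hW.length_eq_ncard, ← Nat.card_coe_set_eq,
    (SimpleGraph.isTree_iff_connected_and_card.1 hS).2, Nat.card_fin]

theorem isLeafOf_iff_sum_eq_one (v : Fin n) :
    IsLeafOf S v ↔ ∑ w, (S.neighborSet v).indicator (fun _ => 1) w = 1 := by
  classical
  simp only [Set.indicator_apply, Finset.sum_boole, Nat.cast_id,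
    Finset.card_eq_one_iff_existsUnique, Finset.mem_filter, Finset.mem_univ, true_and,
    SimpleGraph.mem_neighborSet, IsLeafOf]

end

namespace RealRAM

section

variable {n N : ℕ} {S : SimpleGraph (Fin n)} {W : List (Fin n × Fin n)} {s s₀ : State}

/-- The memory holds the number `n` of vertices and the edge list `W`. -/
structure HoldsEdges (W : List (Fin n × Fin n)) (s : State) : Prop where
  size : s.nat sizeArr 0 = n
  length : s.nat sizeArr 2 = W.length
  ends : ∀ i (hi : i < W.length), s.nat fstEndArr i = W[i].1 ∧ s.nat sndEndArr i = W[i].2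

theorem holdsEdges_inputState (L W : List (Fin n × Fin n)) : HoldsEdges W (inputState n L W) where
  size := rfl
  length := rfl
  ends i hi := by simp [inputState, hi]

theorem HoldsEdges.congr (h : HoldsEdges W s₀)
    (hs : ∀ a ∈ [sizeArr, fstEndArr, sndEndArr], s.nat a = s₀.nat a) : HoldsEdges W s where
  size := by rw [hs sizeArr (by decide), h.size]
  length := by rw [hs sizeArr (by decide), h.length]
  ends i hi := by
    rw [hs fstEndArr (by decide), hs sndEndArr (by decide)]
    exact h.ends i hi

/-- Add the value of `src` at each end of the current edge to the entry of `dst` at the other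
end. -/
def accumulateBody (dst : ℕ) (src : NatExpr → NatExpr) : Program :=
  .setNat dst (.load fstEndArr counter)
      (.add (.load dst (.load fstEndArr counter)) (src (.load sndEndArr counter))) ;;
    .setNat dst (.load sndEndArr counter)
      (.add (.load dst (.load sndEndArr counter)) (src (.load fstEndArr counter)))

/-- Pass through the edge list and store in `dst` the sums of `src` over the neighbours. -/
def accumulate (dst : ℕ) (src : NatExpr → NatExpr) : Program :=
  forLoop sizeArr 2 (accumulateBody dst src)

theorem exec_accumulateBody_nat {dst : ℕ} {src : NatExpr → NatExpr} {f : Fin n → ℕ}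
    {e : Fin n × Fin n} (hfst : s.nat fstEndArr (s.nat counterArr 0) = e.1)
    (hsnd : s.nat sndEndArr (s.nat counterArr 0) = e.2)
    (hdst : dst ∉ [sizeArr, fstEndArr, sndEndArr, counterArr])
    (hsrc : ∀ s', (∀ a ≠ dst, s'.nat a = s.nat a) → ∀ (x : NatExpr) (v : Fin n), x.value s' = v →
      (src x).value s' = f v) (v : Fin n) :
    ((accumulateBody dst src).exec s).nat dst v = s.nat dst v + edgeTerm f v e := by
  simp only [List.mem_cons, List.not_mem_nil, or_false, not_or] at hdst
  obtain ⟨-, hf, hs, hc⟩ := hdst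
  have hload {s' : State} (hs' : ∀ a ≠ dst, s'.nat a = s.nat a) :
      (NatExpr.load fstEndArr counter).value s' = e.1 ∧
        (NatExpr.load sndEndArr counter).value s' = e.2 := by
    simp only [NatExpr.value, counter, hs' _ (Ne.symm hf), hs' _ (Ne.symm hs), hs' _ (Ne.symm hc),
      hfst, hsnd, and_self]
  have hstore (k : ℕ) : ∀ a ≠ dst, (s.storeNat dst e.1 k).nat a = s.nat a :=
    fun a ha => s.storeNat_nat_of_ne ha _ _
  have hsecond := hsrc s (fun _ _ => rfl) _ _ (hload fun _ _ => rfl).2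
  simp only [accumulateBody, Program.exec, NatExpr.value.eq_3, NatExpr.value.eq_2 _ dst, hsecond,
    hload fun _ _ => rfl, hload (hstore _), hsrc _ (hstore _) _ _ (hload (hstore _)).1,
    State.storeNat_nat, edgeTerm, true_and, Fin.val_inj, eq_comm (a := v)]
  split_ifs <;> simp_all [add_assoc]

theorem runs_accumulate (hW : IsEdgeList S W) (hs₀ : HoldsEdges W s₀) (hN : W.length < N)
    {dst : ℕ} (hdst : dst ∉ [sizeArr, fstEndArr, sndEndArr, counterArr])
    (h0 : s₀.nat dst = fun _ => 0) {src : NatExpr → NatExpr} {f : Fin n → ℕ}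
    (hsrc : ∀ s, Frame (accumulate dst src) s₀ s → ∀ (x : NatExpr) (v : Fin n), x.value s = v →
      (src x).value s = f v) :
    Runs N (accumulate dst src) s₀ fun s =>
      ∀ v : Fin n, s.nat dst v = ∑ w, (S.neighborSet v).indicator f w := by
  have hdst' := hdst
  simp only [List.mem_cons, List.not_mem_nil, or_false, not_or] at hdst'
  obtain ⟨hsize, hfst, hsnd, hcounter⟩ := hdst'
  have hwrites {a : ℕ} : a ∈ (accumulate dst src).writes ↔ a = counterArr ∨ a = dst := by
    simp only [accumulate, accumulateBody, forLoop, Program.writes, List.cons_append,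
      List.nil_append, List.mem_cons, List.not_mem_nil, or_false]
    tauto
  have hrun := runs_forLoop (c := sizeArr) (j := 2) (body := accumulateBody dst src)
    ⟨trivial, trivial⟩ (by simp [accumulateBody, Program.writes, Ne.symm hcounter])
    (by simpa [accumulate] using (hwrites (a := sizeArr)).not.2 (by simp [Ne.symm hsize]))
    (hs₀.length.trans_lt hN)
    (fun i s => ∀ v : Fin n, s.nat dst v = ((W.take i).map (edgeTerm f v)).sum)
    (by simp [State.storeNat_nat, h0, hcounter]) fun i s hi hcount hframe hinv v => ?_
  · refine hrun.mono fun s _ hs v => ?_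
    rw [hs, hs₀.length, List.take_length, hW.sum_edgeTerm]
  rw [hs₀.length] at hi
  obtain ⟨hfi, hsi⟩ := (hs₀.congr <| hframe.nat_eq fun a ha => by
    rw [← accumulate, hwrites]
    rintro (rfl | rfl) <;> simp_all).ends i hi
  rw [State.storeNat_nat_of_ne _ hcounter, exec_accumulateBody_nat (e := W[i]) (by rw [hcount, hfi])
    (by rw [hcount, hsi]) hdst (fun s' hs' => hsrc s' fun a ha => by
      rw [hs' a fun h => ha (hwrites.2 (.inr h)), hframe a ha]), hinv v, List.take_add_one]
  simp [hi]

end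

section

variable {n N : ℕ} {S : SimpleGraph (Fin n)} {W : List (Fin n × Fin n)} {s s₀ : State}

/-- The memory holds the marked set `T`, its indicator functions with values one and the vertex
itself, and its cardinality. -/
structure HoldsMarks (T : Set (Fin n)) (s : State) : Prop where
  flag : ∀ v : Fin n, s.nat flagArr v = T.indicator (fun _ => 1) v
  label : ∀ v : Fin n, s.nat labelArr v = T.indicator (fun v => (v : ℕ)) v
  length : s.nat lengthArr 0 = T.ncard

theorem HoldsMarks.congr {T : Set (Fin n)} (h : HoldsMarks T s₀)
    (hs : ∀ a ∈ [flagArr, labelArr, lengthArr], s.nat a = s₀.nat a) : HoldsMarks T s where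
  flag v := by rw [hs flagArr (by decide), h.flag]
  label v := by rw [hs labelArr (by decide), h.label]
  length := by rw [hs lengthArr (by decide), h.length]

theorem holdsMarks_inputState (L W : List (Fin n × Fin n)) :
    HoldsMarks (∅ : Set (Fin n)) (inputState n L W) where
  flag := by simp [inputState]
  label := by simp [inputState]
  length := by simp [inputState]

/-- Mark the current vertex. -/
def markCurrent : Program :=
  .setNat flagArr counter (.const 1) ;; .setNat labelArr counter counter ;;
    .setNat lengthArr (.const 0) (.add (.load lengthArr (.const 0)) (.const 1))

theorem HoldsMarks.insert {T : Set (Fin n)} (h : HoldsMarks T s) {v : Fin n} (hv : v ∉ T)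
    (hcount : s.nat counterArr 0 = v) : HoldsMarks (insert v T) (markCurrent.exec s) where
  flag w := by
    classical
    by_cases hw : w = v <;>
      simp [markCurrent, Program.exec, State.storeNat_nat, counter, NatExpr.value, hcount,
        Fin.val_inj, h.flag, hw, Set.indicator_apply]
  label w := by
    classical
    by_cases hw : w = v <;>
      simp [markCurrent, Program.exec, State.storeNat_nat, counter, NatExpr.value, hcount,
        Fin.val_inj, h.label, hw, Set.indicator_apply]
  length := by
    simp [markCurrent, Program.exec, State.storeNat_nat, NatExpr.value, h.length,
      Set.ncard_insert_of_notMem hv]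

/-- The truncated difference `3 - (n + v)` for the current vertex `v`. -/
def lowIndexExpr : NatExpr := .sub (.const 3) (.add (.load sizeArr (.const 0)) counter)

/-- Mark the current vertex if it belongs to `markedSpine`. Twice the truncated difference is zero,
unless `n + v ≤ 2`: then it is at least two, and the test fails for every degree. -/
def markBody : Program :=
  .ite (.natEq (.add (.load degreeArr counter) (.add lowIndexExpr lowIndexExpr)) (.const 1)) .skip
    markCurrent

theorem exec_markBody (hsize : s.nat sizeArr 0 = n) {v : Fin n} (hcount : s.nat counterArr 0 = v)
    (hdegree : s.nat degreeArr v = ∑ w, (S.neighborSet v).indicator (fun _ => 1) w) :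
    (v ∈ markedSpine S → markBody.exec s = markCurrent.exec s) ∧
      (v ∉ markedSpine S → markBody.exec s = s) := by
  have htest : (Test.natEq (.add (.load degreeArr counter) (.add lowIndexExpr lowIndexExpr))
      (.const 1)).Holds s ↔ v ∉ markedSpine S := by
    simp only [Test.Holds, lowIndexExpr, NatExpr.value, counter, hcount, hsize, hdegree,
      markedSpine, Set.mem_ofPred_eq, isLeafOf_iff_sum_eq_one]
    omega
  exact ⟨fun h => if_neg (htest.not_left.2 h), fun h => if_pos (htest.2 h)⟩

theorem runs_mark (hsize : s₀.nat sizeArr 0 = n) (hN : n < N)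
    (hdegree : ∀ v : Fin n,
      s₀.nat degreeArr v = ∑ w, (S.neighborSet v).indicator (fun _ => 1) w)
    (h0 : HoldsMarks (∅ : Set (Fin n)) s₀) :
    Runs N (forLoop sizeArr 0 markBody) s₀ (HoldsMarks (markedSpine S)) := by
  have hrun := runs_forLoop (c := sizeArr) (j := 0) (body := markBody)
    ⟨trivial, trivial, trivial, trivial⟩ (by decide) (by decide) (s₀ := s₀) (hsize.trans_lt hN)
    (fun i => HoldsMarks {v ∈ markedSpine S | (v : ℕ) < i}) ?_ fun i s hi hcount hframe hinv => ?_
  · rw [hsize] at hrun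
    simpa only [Fin.is_lt, and_true, Set.ofPred_mem_eq] using hrun
  · simpa using h0.congr fun a ha =>
      s₀.storeNat_nat_of_ne (by rintro rfl; simp at ha) 0 0
  rw [hsize] at hi
  have hset (v : Fin n) : (v : ℕ) < i + 1 ↔ v = ⟨i, hi⟩ ∨ (v : ℕ) < i := by
    rw [Nat.lt_succ_iff_lt_or_eq, or_comm, Fin.ext_iff]
  refine HoldsMarks.congr (s₀ := markBody.exec s) ?_ fun a ha =>
    State.storeNat_nat_of_ne _ (by rintro rfl; simp at ha) _ _
  obtain ⟨hmem, hnotMem⟩ := exec_markBody (s := s) (v := ⟨i, hi⟩) (S := S)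
    (by rw [hframe sizeArr (by decide), hsize]) hcount
    (by rw [hframe degreeArr (by decide), hdegree])
  by_cases hi' : ⟨i, hi⟩ ∈ markedSpine S
  · rw [hmem hi']
    convert hinv.insert (v := ⟨i, hi⟩) (by simp) hcount using 1
    ext v
    simp only [hset, Set.mem_insert_iff, Set.mem_ofPred_eq]
    grind
  · rw [hnotMem hi']
    convert hinv using 1
    ext v
    simp only [hset, Set.mem_ofPred_eq]
    grind

end

section

variable {n N : ℕ} {S : SimpleGraph (Fin n)} {W : List (Fin n × Fin n)} {s s₀ : State}
  {spine : Set (Fin n)}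

/-- The memory holds the set `spine` and, for each vertex, the number and the sum of its neighbours
in this set. The sum is the name of the neighbour of a vertex with only one, and it lets a walk
continue from a vertex with two. -/
structure HoldsSpine (S : SimpleGraph (Fin n)) (spine : Set (Fin n)) (s : State) : Prop where
  size : s.nat sizeArr 0 = n
  marks : HoldsMarks spine s
  spineDegree : ∀ v : Fin n,
    s.nat spineDegreeArr v = ∑ w, (S.neighborSet v ∩ spine).indicator (fun _ => 1) w
  neighbor : ∀ v : Fin n,
    s.nat neighborArr v = ∑ w, (S.neighborSet v ∩ spine).indicator (fun w => (w : ℕ)) w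

theorem HoldsSpine.congr (h : HoldsSpine S spine s₀)
    (hs : ∀ a ∈ [sizeArr, flagArr, labelArr, lengthArr, spineDegreeArr, neighborArr],
      s.nat a = s₀.nat a) : HoldsSpine S spine s where
  size := by rw [hs sizeArr (by decide), h.size]
  marks := h.marks.congr fun a ha => hs a (by simp at ha ⊢; tauto)
  spineDegree v := by rw [hs spineDegreeArr (by decide), h.spineDegree]
  neighbor v := by rw [hs neighborArr (by decide), h.neighbor]

/-- Find the vertices of the spine and, for each vertex, the sums over its neighbours there. -/
def findSpine : Program :=
  accumulate degreeArr (fun _ => .const 1) ;; forLoop sizeArr 0 markBody ;;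
    accumulate spineDegreeArr (.load flagArr) ;; accumulate neighborArr (.load labelArr)

theorem runs_findSpine (hW : IsEdgeList S W) (hN : W.length < N) (hnN : n < N)
    (L : List (Fin n × Fin n)) :
    Runs N findSpine (inputState n L W) (HoldsSpine S (markedSpine S)) := by
  have hedges := holdsEdges_inputState L W
  refine (runs_accumulate hW hedges hN (by decide) rfl (f := fun _ => 1)
    fun _ _ _ _ _ => rfl).seq fun s₁ hframe₁ hdegree => ?_
  refine (runs_mark (by rw [hframe₁ _ (by decide), hedges.size]) hnN hdegree
    ((holdsMarks_inputState L W).congr (hframe₁.nat_eq (by decide)))).seq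
    fun s₂ hframe₂ hmarks₂ => ?_
  have hedges₂ := (hedges.congr (hframe₁.nat_eq (by decide))).congr (hframe₂.nat_eq (by decide))
  refine (runs_accumulate hW hedges₂ hN (by decide)
    (by rw [hframe₂ _ (by decide), hframe₁ _ (by decide)]; rfl)
    (f := (markedSpine S).indicator fun _ => 1) fun s hframe x v hx => ?_).seq
    fun s₃ hframe₃ hspineDegree => ?_
  · rw [NatExpr.value, hframe _ (by decide), hx, hmarks₂.flag]
  have hmarks₃ := hmarks₂.congr (hframe₃.nat_eq (by decide))
  refine (runs_accumulate hW (hedges₂.congr (hframe₃.nat_eq (by decide))) hN (by decide)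
    (by rw [hframe₃ _ (by decide), hframe₂ _ (by decide), hframe₁ _ (by decide)]; rfl)
    (f := (markedSpine S).indicator fun v => v) fun s hframe x v hx => ?_).mono
    fun s₄ hframe₄ hneighbor => ?_
  · rw [NatExpr.value, hframe _ (by decide), hx, hmarks₃.label]
  simp only [Set.indicator_indicator] at hspineDegree hneighbor
  exact
    { size := by rw [hframe₄ _ (by decide), hframe₃ _ (by decide), hedges₂.size]
      marks := hmarks₃.congr (hframe₄.nat_eq (by decide))
      spineDegree v := by rw [hframe₄ _ (by decide), hspineDegree]
      neighbor := hneighbor }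

end

section

variable {n N k : ℕ} {S : SimpleGraph (Fin n)} {s s₀ : State} {spine : Set (Fin n)}
  {parent : Fin n → Fin n} {u : ℕ → Fin n}

theorem HoldsSpine.flag_eq_one_iff (hs : HoldsSpine S spine s) (v : Fin n) :
    s.nat flagArr v = 1 ↔ v ∈ spine := by
  classical
  simp [hs.marks.flag, Set.indicator_apply]

theorem HoldsSpine.neighbor_eq_parent (hs : HoldsSpine S spine s)
    (h : IsSpinePath S spine parent k u) {v : Fin n} (hv : v ∉ spine) :
    s.nat neighborArr v = parent v := by
  rw [hs.neighbor, h.sum_spine_neighbors_of_notMem hv]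

/-- The memory holds the number of leaves of each vertex and the rank of each leaf, where only the
leaves below `i` are taken into account. -/
structure HoldsLeaves (spine : Set (Fin n)) (parent : Fin n → Fin n) (i : ℕ) (s : State) :
    Prop where
  count : ∀ v : Fin n,
    s.nat leafCountArr v = {w : Fin n | (w : ℕ) < i ∧ w ∉ spine ∧ parent w = v}.ncard
  rank : ∀ v ∉ spine, (v : ℕ) < i → s.nat leafRankArr v = leafRank spine parent v

theorem HoldsLeaves.congr {i : ℕ} (h : HoldsLeaves spine parent i s₀)
    (hs : ∀ a ∈ [leafCountArr, leafRankArr], s.nat a = s₀.nat a) :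
    HoldsLeaves spine parent i s where
  count v := by rw [hs leafCountArr (by decide), h.count]
  rank v hv hi := by rw [hs leafRankArr (by decide), h.rank v hv hi]

theorem HoldsLeaves.count_eq_leafCount (h : HoldsLeaves spine parent n s) (v : Fin n) :
    s.nat leafCountArr v = leafCount spine parent v := by
  simp [h.count, leafCount]

open Classical in
theorem ncard_leaves_succ (spine : Set (Fin n)) (parent : Fin n → Fin n) (u v : Fin n) :
    {w : Fin n | (w : ℕ) < v + 1 ∧ w ∉ spine ∧ parent w = u}.ncard =
      {w : Fin n | (w : ℕ) < v ∧ w ∉ spine ∧ parent w = u}.ncard +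
        if v ∉ spine ∧ parent v = u then 1 else 0 := by
  have hset (w : Fin n) : (w : ℕ) < v + 1 ↔ w = v ∨ (w : ℕ) < v := by
    rw [Nat.lt_succ_iff_lt_or_eq, or_comm, Fin.ext_iff]
  split_ifs with hv
  · rw [← Set.ncard_insert_of_notMem (a := v) fun h => lt_irrefl _ h.1]
    congr 1
    ext w
    simp only [hset, Set.mem_insert_iff, Set.mem_ofPred_eq]
    grind
  · rw [add_zero]
    congr 1
    ext w
    simp only [hset, Set.mem_ofPred_eq]
    grind

/-- If the current vertex is a leaf, let its rank be the current number of leaves of its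
neighbour, and increase this number. -/
def rankBody : Program :=
  .ite (.natEq (.load flagArr counter) (.const 1)) .skip
    (.setNat leafRankArr counter (.load leafCountArr (.load neighborArr counter)) ;;
      .setNat leafCountArr (.load neighborArr counter)
        (.add (.load leafCountArr (.load neighborArr counter)) (.const 1)))

theorem HoldsLeaves.exec_rankBody (h : IsSpinePath S spine parent k u)
    (hs : HoldsSpine S spine s) {v : Fin n} (hcount : s.nat counterArr 0 = v)
    (hl : HoldsLeaves spine parent v s) : HoldsLeaves spine parent (v + 1) (rankBody.exec s) := by
  have htest : (Test.natEq (.load flagArr counter) (.const 1)).Holds s ↔ v ∈ spine := by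
    simp only [Test.Holds, NatExpr.value, counter, hcount, hs.flag_eq_one_iff]
  by_cases hv : v ∈ spine
  · rw [rankBody, Program.exec, if_pos (htest.2 hv)]
    refine ⟨fun w => ?_, fun w hw hwv => hl.rank w hw ?_⟩
    · rw [ncard_leaves_succ, if_neg fun h => h.1 hv, add_zero]
      exact hl.count w
    · exact lt_of_le_of_ne (Nat.lt_succ_iff.1 hwv) fun hne => hw (Fin.ext hne ▸ hv)
  · rw [rankBody, Program.exec, if_neg (htest.not.2 hv)]
    refine ⟨fun w => ?_, fun w hw hwv => ?_⟩
    · rw [ncard_leaves_succ]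
      by_cases hw : w = parent v
      · simp [Program.exec, State.storeNat_nat, NatExpr.value, counter, hcount, hl.count,
          hs.neighbor_eq_parent h hv, hv, hw]
      · simp [Program.exec, State.storeNat_nat, NatExpr.value, counter, hcount, hl.count,
          hs.neighbor_eq_parent h hv, Fin.val_inj, hw, Ne.symm hw]
    · by_cases hw' : w = v
      · simp [Program.exec, State.storeNat_nat, NatExpr.value, counter, hcount, hl.count,
          hs.neighbor_eq_parent h hv, hw', leafRank]
      · simp [Program.exec, State.storeNat_nat, NatExpr.value, counter, hcount, Fin.val_inj, hw',
          hl.rank w hw (by omega)]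

theorem runs_rank (h : IsSpinePath S spine parent k u) (hs₀ : HoldsSpine S spine s₀) (hN : n < N)
    (h0 : s₀.nat leafCountArr = fun _ => 0) :
    Runs N (forLoop sizeArr 0 rankBody) s₀ (HoldsLeaves spine parent n) := by
  have hstore {s : State} {i : ℕ} (k : ℕ) (hs : HoldsLeaves spine parent i s) :
      HoldsLeaves spine parent i (s.storeNat counterArr 0 k) :=
    hs.congr fun a ha => s.storeNat_nat_of_ne (by rintro rfl; simp at ha) 0 k
  have hrun := runs_forLoop (c := sizeArr) (j := 0) (body := rankBody) ⟨trivial, trivial, trivial⟩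
    (by decide) (by decide) (hs₀.size.trans_lt hN) (HoldsLeaves spine parent)
    (hstore 0 ⟨by simp [h0], by simp⟩) fun i s hi hcount hframe hl => ?_
  · rwa [hs₀.size] at hrun
  · obtain ⟨v, rfl⟩ : ∃ v : Fin n, i = v := ⟨⟨i, hs₀.size ▸ hi⟩, rfl⟩
    exact hstore _ (hl.exec_rankBody h (hs₀.congr (hframe.nat_eq (by decide))) hcount)

/-- If the current vertex is an end of the spine, remember it. Twice the flag is two on the spine
and zero elsewhere, so that one comparison is sufficient. -/
def startBody : Program :=
  .ite (.natLt (.load spineDegreeArr counter)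
      (.add (.load flagArr counter) (.load flagArr counter)))
    (.setNat currentArr (.const 0) counter) .skip

theorem runs_start (hs₀ : HoldsSpine S spine s₀) (hN : n < N)
    (hend : ∃ v ∈ spine, ∑ w, (S.neighborSet v ∩ spine).indicator (fun _ => 1) w < 2) :
    Runs N (forLoop sizeArr 0 startBody) s₀ fun s =>
      ∃ v ∈ spine, ∑ w, (S.neighborSet v ∩ spine).indicator (fun _ => 1) w < 2 ∧
        s.nat currentArr 0 = v := by
  classical
  have hrun := runs_forLoop (c := sizeArr) (j := 0) (body := startBody) ⟨trivial, trivial⟩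
    (by decide) (by decide) (hs₀.size.trans_lt hN)
    (fun i s => (∃ v ∈ spine, (v : ℕ) < i ∧
        ∑ w, (S.neighborSet v ∩ spine).indicator (fun _ => 1) w < 2) →
      ∃ v ∈ spine, ∑ w, (S.neighborSet v ∩ spine).indicator (fun _ => 1) w < 2 ∧
        s.nat currentArr 0 = v)
    (by simp) fun i s hi hcount hframe hinv ⟨v, hv, hvi, hdeg⟩ => ?_
  · rw [hs₀.size] at hrun
    exact hrun.mono fun s _ hs => hs <| hend.imp fun v hv => ⟨hv.1, v.2, hv.2⟩
  obtain ⟨x, rfl⟩ : ∃ x : Fin n, i = x := ⟨⟨i, hs₀.size ▸ hi⟩, rfl⟩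
  have hs := hs₀.congr (hframe.nat_eq (by decide))
  have htest : (Test.natLt (.load spineDegreeArr counter)
      (.add (.load flagArr counter) (.load flagArr counter))).Holds s ↔
      x ∈ spine ∧ ∑ w, (S.neighborSet x ∩ spine).indicator (fun _ => 1) w < 2 := by
    simp only [Test.Holds, NatExpr.value, counter, hcount, hs.spineDegree, hs.marks.flag,
      Set.indicator_apply]
    split_ifs with hx <;> simp [hx]
  by_cases hx : x ∈ spine ∧ ∑ w, (S.neighborSet x ∩ spine).indicator (fun _ => 1) w < 2
  · rw [startBody, Program.exec, if_pos (htest.2 hx)]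
    refine ⟨x, hx.1, hx.2, ?_⟩
    simp [Program.exec, State.storeNat_nat, NatExpr.value, counter, hcount]
  · rw [startBody, Program.exec, if_neg (htest.not.2 hx)]
    have hne : (v : ℕ) ≠ x := fun hne => hx (Fin.ext hne ▸ ⟨hv, hdeg⟩)
    simpa [Program.exec, State.storeNat_nat] using hinv ⟨v, hv, by omega, hdeg⟩

end

/-! ## Walking along the spine -/

section

variable {n N k : ℕ} {S : SimpleGraph (Fin n)} {s s₀ : State} {spine : Set (Fin n)}
  {parent : Fin n → Fin n} {u : ℕ → Fin n}

/-- The memory describes the situation on a walk along the path `u` after `i` steps, when the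
first `i` blocks have been placed. -/
structure HoldsWalk (spine : Set (Fin n)) (parent : Fin n → Fin n) (k : ℕ) (u : ℕ → Fin n) (i : ℕ)
    (s : State) : Prop where
  current : i < k → s.nat currentArr 0 = u i
  previous : s.nat previousArr 0 = if i = 0 then 0 else (u (i - 1) : ℕ)
  used : s.nat usedSlotsArr 0 + 1 = blockStart spine parent u i
  start : ∀ j < i, s.nat startArr (u j) = blockStart spine parent u j

theorem HoldsWalk.congr {i : ℕ} (h : HoldsWalk spine parent k u i s₀)
    (hs : ∀ a ∈ [currentArr, previousArr, usedSlotsArr, startArr], s.nat a = s₀.nat a) :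
    HoldsWalk spine parent k u i s where
  current hi := by rw [hs currentArr (by decide), h.current hi]
  previous := by rw [hs previousArr (by decide), h.previous]
  used := by rw [hs usedSlotsArr (by decide), h.used]
  start j hj := by rw [hs startArr (by decide), h.start j hj]

/-- The current vertex of the walk. -/
def currentVertex : NatExpr := .load currentArr (.const 0)

/-- The number of slots in the blocks that have been placed. -/
def usedSlots : NatExpr := .load usedSlotsArr (.const 0)

/-- Place the block of the current vertex and go to the next vertex, whose name is the sum of the
names of the neighbours on the spine minus the name of the previous vertex. -/
def walkBody : Program :=
  .setNat startArr currentVertex (.add usedSlots (.const 1)) ;;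
    .setNat usedSlotsArr (.const 0) (.add usedSlots
      (.add (.add (.load leafCountArr currentVertex) (.const 1))
        (.add (.load leafCountArr currentVertex) (.const 1)))) ;;
    .setNat nextArr (.const 0)
      (.sub (.load neighborArr currentVertex) (.load previousArr (.const 0))) ;;
    .setNat previousArr (.const 0) currentVertex ;;
    .setNat currentArr (.const 0) (.load nextArr (.const 0))

theorem HoldsWalk.exec_walkBody (h : IsSpinePath S spine parent k u) (hs : HoldsSpine S spine s)
    (hcount : ∀ v : Fin n, s.nat leafCountArr v = leafCount spine parent v) {i : ℕ} (hi : i < k)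
    (hw : HoldsWalk spine parent k u i s) :
    HoldsWalk spine parent k u (i + 1) (walkBody.exec s) where
  current hi' := by
    simp [walkBody, currentVertex, Program.exec, State.storeNat_nat, NatExpr.value, hw.current hi,
      hw.previous, hs.neighbor, h.sum_spine_neighbors_apply hi, hi']
  previous := by
    simp [walkBody, currentVertex, Program.exec, State.storeNat_nat, NatExpr.value, hw.current hi]
  used := by
    rw [blockStart_succ, ← hw.used]
    simp [walkBody, currentVertex, usedSlots, Program.exec, State.storeNat_nat, NatExpr.value,
      hw.current hi, hcount]
    ring
  start j hj := by
    have hstart : (walkBody.exec s).nat startArr (u j) =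
        if (u j : ℕ) = u i then blockStart spine parent u i else s.nat startArr (u j) := by
      simp [walkBody, currentVertex, usedSlots, Program.exec, State.storeNat_nat, NatExpr.value,
        hw.current hi, hw.used]
    rcases Nat.lt_succ_iff_lt_or_eq.1 hj with hlt | rfl
    · rw [hstart, if_neg fun hne => hlt.ne (h.bijOn.injOn (hlt.trans hi) hi (Fin.ext hne)),
        hw.start j hlt]
    · rw [hstart, if_pos rfl]

theorem runs_walk (h : IsSpinePath S spine parent k u) (hs₀ : HoldsSpine S spine s₀)
    (hcount : ∀ v : Fin n, s₀.nat leafCountArr v = leafCount spine parent v) (hN : k < N)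
    (hw : HoldsWalk spine parent k u 0 s₀) :
    Runs N (forLoop lengthArr 0 walkBody) s₀ (HoldsWalk spine parent k u k) := by
  have hstore {s : State} {i : ℕ} (c : ℕ) (hs : HoldsWalk spine parent k u i s) :
      HoldsWalk spine parent k u i (s.storeNat counterArr 0 c) :=
    hs.congr fun a ha => s.storeNat_nat_of_ne (by rintro rfl; simp at ha) 0 c
  have hlength : s₀.nat lengthArr 0 = k := hs₀.marks.length.trans h.ncard_spine
  have hrun := runs_forLoop (c := lengthArr) (j := 0) (body := walkBody)
    ⟨trivial, trivial, trivial, trivial, trivial⟩ (by decide) (by decide) (hlength.trans_lt hN)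
    (HoldsWalk spine parent k u) (hstore 0 hw) fun i s hi _ hframe hw => ?_
  · rwa [hlength] at hrun
  · refine hstore _ (hw.exec_walkBody h (hs₀.congr (hframe.nat_eq (by decide))) (fun v => ?_)
      (hlength ▸ hi))
    rw [hframe _ (by decide), hcount]

end

/-! ## Computing the coordinates -/

section

variable {n N : ℕ} {s s₀ : State} {l : BlockLayout (Fin n)}

/-- The memory holds a block layout. -/
structure HoldsLayout (l : BlockLayout (Fin n)) (s : State) : Prop where
  size : s.nat sizeArr 0 = l.n
  flag : ∀ v : Fin n, s.nat flagArr v = 1 ↔ v ∈ l.spine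
  start : ∀ v ∈ l.spine, s.nat startArr v = l.start v
  parent : ∀ v ∉ l.spine, s.nat neighborArr v = l.parent v
  half : ∀ v : Fin n, s.nat leafCountArr v + 1 = l.half v
  idx : ∀ v ∉ l.spine, s.nat leafRankArr v = l.idx v

theorem HoldsLayout.congr (h : HoldsLayout l s₀)
    (hs : ∀ a ∈ [sizeArr, flagArr, startArr, neighborArr, leafCountArr, leafRankArr],
      s.nat a = s₀.nat a) : HoldsLayout l s where
  size := by rw [hs sizeArr (by decide), h.size]
  flag v := by rw [hs flagArr (by decide), h.flag]
  start v hv := by rw [hs startArr (by decide), h.start v hv]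
  parent v hv := by rw [hs neighborArr (by decide), h.parent v hv]
  half v := by rw [hs leafCountArr (by decide), h.half]
  idx v hv := by rw [hs leafRankArr (by decide), h.idx v hv]

/-- The expression for `slotAngle`. -/
def slotAngleExpr : RealExpr :=
  .div (.arctan (.cast (.const 1))) (.cast (.add (.load sizeArr (.const 0)) (.const 1)))

theorem slotAngleExpr_value (s : State) :
    slotAngleExpr.value s = slotAngle (s.nat sizeArr 0) := by
  simp [slotAngleExpr, RealExpr.value, NatExpr.value, slotAngle, div_div]

/-- The expression for `spineRadius`. -/
def spineRadiusExpr : RealExpr :=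
  .mul (.cast (.const 4)) (.cast (.add (.load sizeArr (.const 0)) (.const 1)))

theorem spineRadiusExpr_value (s : State) :
    spineRadiusExpr.value s = spineRadius (s.nat sizeArr 0) := by
  simp [spineRadiusExpr, RealExpr.value, NatExpr.value, spineRadius]

/-- The expression for `leafWeight`. -/
def leafWeightExpr (μ ε : RealExpr) : RealExpr :=
  .div (.cast (.const 2)) (.mul (.sin μ) (.sin ε))

/-- The expression for `leafRadius`. -/
def leafRadiusExpr (μ ε φ : RealExpr) : RealExpr :=
  let x : RealExpr := .mul (leafWeightExpr μ ε) (.cos (.add φ ε))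
  let y : RealExpr := .mul (leafWeightExpr μ ε) (.cos (.add μ ε))
  .div (.sub (.sqrt (.add (.mul x x) (.mul (.cast (.const 4)) (.add (.cast (.const 1)) y)))) x)
    (.cast (.const 2))

theorem leafRadiusExpr_value (μ ε φ : RealExpr) (s : State) :
    (leafRadiusExpr μ ε φ).value s = leafRadius (μ.value s) (ε.value s) (φ.value s) := by
  simp [leafRadiusExpr, leafWeightExpr, RealExpr.value, NatExpr.value, leafRadius, leafWeight, sq]

/-- Half the number of slots in the block of the current vertex, a leaf. -/
def halfBlockExpr : NatExpr :=
  .add (.load leafCountArr (.load neighborArr counter)) (.const 1)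

/-- Compute the slot and the relative polar radius of the current vertex. -/
def polarBody : Program :=
  .ite (.natEq (.load flagArr counter) (.const 1))
    (.setNat slotArr (.const 0) (.load startArr counter) ;;
      .setReal radiusArr (.const 0) (.cast (.const 1)))
    (.setNat slotArr (.const 0) (.add (.add (.load startArr (.load neighborArr counter))
        halfBlockExpr) (.load leafRankArr counter)) ;;
      .setReal radiusArr (.const 0)
        (leafRadiusExpr (.mul (.cast halfBlockExpr) slotAngleExpr)
          (.div slotAngleExpr (.cast (.const 2)))
          (.mul (.cast (.load leafRankArr counter)) slotAngleExpr)))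

theorem HoldsLayout.exec_polarBody (hs : HoldsLayout l s) {v : Fin n}
    (hcount : s.nat counterArr 0 = v) :
    polarBody.exec s = (s.storeNat slotArr 0 (l.slot v)).storeReal radiusArr 0 (l.rad v) := by
  have htest : (Test.natEq (.load flagArr counter) (.const 1)).Holds s ↔ v ∈ l.spine := by
    simp only [Test.Holds, NatExpr.value, counter, hcount, hs.flag]
  by_cases hv : v ∈ l.spine
  · rw [polarBody, Program.exec, if_pos (htest.2 hv), BlockLayout.slot_of_mem hv,
      BlockLayout.rad_of_mem hv]
    simp [Program.exec, NatExpr.value, RealExpr.value, counter, hcount, hs.start v hv]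
  · rw [polarBody, Program.exec, if_neg (htest.not.2 hv), BlockLayout.slot_of_notMem hv,
      BlockLayout.rad_of_notMem hv]
    simp [Program.exec, NatExpr.value, RealExpr.value, State.storeNat_nat, counter, hcount,
      halfBlockExpr, leafRadiusExpr_value, slotAngleExpr_value, hs.parent v hv,
      hs.start _ (l.parent_mem v hv), hs.half, hs.idx v hv, hs.size]

/-- Compute the coordinates of the current vertex. -/
def coordinateBody : Program :=
  let radius : RealExpr := .mul spineRadiusExpr (.load radiusArr (.const 0))
  let angle : RealExpr := .mul (.cast (.load slotArr (.const 0))) slotAngleExpr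
  polarBody ;; .setReal 0 counter (.sub (.cast (.const 0)) (.mul radius (.cos angle))) ;;
    .setReal 1 counter (.mul radius (.sin angle))

theorem HoldsLayout.outputDrawing_exec_coordinateBody (hs : HoldsLayout l s) {v : Fin n}
    (hcount : s.nat counterArr 0 = v) :
    outputDrawing n (coordinateBody.exec s) = Function.update (outputDrawing n s) v (l.pos v) := by
  ext w i
  fin_cases i <;> by_cases hw : w = v <;>
    simp [coordinateBody, outputDrawing, Program.exec, hs.exec_polarBody hcount, NatExpr.value,
      RealExpr.value, State.storeNat_nat, State.storeReal_real, counter, hcount, hs.size,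
      slotAngleExpr_value, spineRadiusExpr_value, BlockLayout.pos, polarPoint, Fin.val_inj, hw]

theorem runs_coordinate (hs₀ : HoldsLayout l s₀) (hn : l.n = n) (hN : n < N) :
    Runs N (forLoop sizeArr 0 coordinateBody) s₀ fun s => outputDrawing n s = l.pos := by
  have hsize : s₀.nat sizeArr 0 = n := hs₀.size.trans hn
  have hrun := runs_forLoop (c := sizeArr) (j := 0) (body := coordinateBody)
    ⟨⟨⟨trivial, trivial⟩, trivial, trivial⟩, trivial, trivial⟩ (by decide) (by decide)
    (hsize.trans_lt hN) (fun i s => ∀ v : Fin n, (v : ℕ) < i → outputDrawing n s v = l.pos v)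
    (by simp) fun i s hi hcount hframe hinv w hw => ?_
  · rw [hsize] at hrun
    exact hrun.mono fun s _ hs => funext fun v => hs v v.2
  obtain ⟨v, rfl⟩ : ∃ v : Fin n, i = v := ⟨⟨i, hsize ▸ hi⟩, rfl⟩
  have hs := hs₀.congr (hframe.nat_eq (by decide))
  change outputDrawing n (coordinateBody.exec s) w = l.pos w
  rw [hs.outputDrawing_exec_coordinateBody hcount]
  by_cases hwv : w = v
  · rw [hwv, Function.update_self]
  · rw [Function.update_of_ne hwv, hinv w (by omega)]

end

/-! ## The drawing program -/

section

variable {n N k : ℕ} {S : SimpleGraph (Fin n)} {W : List (Fin n × Fin n)} {s : State}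
  {spine : Set (Fin n)} {parent : Fin n → Fin n} {u : ℕ → Fin n}

theorem holdsLayout (h : IsSpinePath S spine parent k u) (hs : HoldsSpine S spine s)
    (hl : HoldsLeaves spine parent n s) (hw : HoldsWalk spine parent k u k s) :
    HoldsLayout h.layout s where
  size := hs.size.trans (Nat.card_fin n).symm
  flag := hs.flag_eq_one_iff
  start v hv := by
    obtain ⟨i, hi, rfl⟩ := h.exists_eq hv
    rw [hw.start i hi, h.layout_start hi]
  parent v hv := hs.neighbor_eq_parent h hv
  half v := congrArg (· + 1) (hl.count_eq_leafCount v)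
  idx v hv := hl.rank v hv v.2

/-- Compute the block layout. -/
def layoutProgram : Program :=
  findSpine ;; forLoop sizeArr 0 rankBody ;; forLoop sizeArr 0 startBody ;;
    forLoop lengthArr 0 walkBody

theorem runs_layoutProgram (h : IsSpinePath S (markedSpine S) parent k u) (hW : IsEdgeList S W)
    (hN : W.length < N) (hnN : n < N) (L : List (Fin n × Fin n)) :
    Runs N layoutProgram (inputState n L W) fun s =>
      ∃ (u' : ℕ → Fin n) (h' : IsSpinePath S (markedSpine S) parent k u'),
        HoldsLayout h'.layout s := by
  refine (runs_findSpine hW hN hnN L).seq fun s₁ hframe₁ hs₁ => ?_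
  refine (runs_rank h hs₁ hnN (hframe₁ leafCountArr (by decide))).seq fun s₂ hframe₂ hl₂ => ?_
  have hs₂ := hs₁.congr (hframe₂.nat_eq (by decide))
  have hend : ∑ w, (S.neighborSet (u 0) ∩ markedSpine S).indicator (fun _ => 1) w < 2 := by
    rw [h.sum_spine_neighbors_apply h.length_pos, if_pos rfl]
    split_ifs <;> decide
  refine (runs_start hs₂ hnN ⟨u 0, h.mem h.length_pos, hend⟩).seq
    fun s₃ hframe₃ ⟨v, hv, hdeg, hstart⟩ => ?_
  have hs₃ := hs₂.congr (hframe₃.nat_eq (by decide))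
  have hl₃ := hl₂.congr (hframe₃.nat_eq (by decide))
  obtain ⟨u', rfl, h'⟩ := h.exists_reordering hv hdeg
  have hzero {a : ℕ} (ha : a ∈ [previousArr, usedSlotsArr]) :
      s₃.nat a 0 = (inputState n L W).nat a 0 := by
    rw [hframe₃.nat_eq (by decide) a ha, hframe₂.nat_eq (by decide) a ha,
      hframe₁.nat_eq (by decide) a ha]
  have hkN : k < N := by
    rw [← h.ncard_spine]
    exact (Set.ncard_le_card _).trans_lt (by rwa [Nat.card_fin])
  refine (runs_walk h' hs₃ hl₃.count_eq_leafCount hkN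
    { current _ := hstart
      previous := hzero (by decide)
      used := congrArg (· + 1) (hzero (by decide))
      start := by simp }).mono fun s₄ hframe₄ hw₄ => ⟨u', h', ?_⟩
  exact holdsLayout h' (hs₃.congr (hframe₄.nat_eq (by decide)))
    (hl₃.congr (hframe₄.nat_eq (by decide))) hw₄

/-- Compute the drawing. -/
def drawProgram : Program := layoutProgram ;; forLoop sizeArr 0 coordinateBody

theorem runs_drawProgram (h : IsSpinePath S (markedSpine S) parent k u) (hW : IsEdgeList S W)
    (hN : W.length < N) (hnN : n < N) (L : List (Fin n × Fin n)) :
    Runs N drawProgram (inputState n L W) fun s =>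
      ∃ (u' : ℕ → Fin n) (h' : IsSpinePath S (markedSpine S) parent k u'),
        outputDrawing n s = h'.layout.pos :=
  (runs_layoutProgram h hW hN hnN L).seq fun _ _ ⟨u', h', hlayout⟩ =>
    (runs_coordinate hlayout (Nat.card_fin n) hnN).mono fun _ _ hpos => ⟨u', h', hpos⟩

end

end RealRAM

theorem drawingArea_layout_le {n k : ℕ} (G : SimpleGraph (Fin n)) {S : SimpleGraph (Fin n)}
    {spine : Set (Fin n)} {parent : Fin n → Fin n} {u : ℕ → Fin n}
    (h : IsSpinePath S spine parent k u) : drawingArea G h.layout.pos ≤ 64 * (n : ℝ) ^ 2 := by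
  have : Nonempty (Fin n) := ⟨u 0⟩
  have hn : (1 : ℝ) ≤ n := by exact_mod_cast Fin.pos (u 0)
  calc drawingArea G h.layout.pos ≤ spineRadius (Nat.card (Fin n)) ^ 2 :=
        drawingArea_le G h.layout.pos_mem_quadrant
    _ ≤ 64 * (n : ℝ) ^ 2 := by
        rw [Nat.card_fin, spineRadius]
        nlinarith

theorem theorem2_general :
    ∃ (P : RealRAM.Program) (C : ℕ),
      ∀ (n : ℕ) (S : SimpleGraph (Fin n)), IsCaterpillar S →
        ∀ L W : List (Fin n × Fin n), IsEdgeList S W →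
          ∃ (t : ℕ) (s : RealRAM.State),
            RealRAM.Run P (inputState n L W) t s ∧
            t ≤ C * n ∧
            IsQuarterCircleLayout S (outputDrawing n s) ∧
            HasUnitResolution (outputDrawing n s) ∧
            ∀ G : SimpleGraph (Fin n),
              IsCompatibleDrawing G S (outputDrawing n s) ∧
              drawingArea G (outputDrawing n s) ≤ C * (n : ℝ) ^ 2 := by
  refine ⟨RealRAM.drawProgram, 2 * RealRAM.drawProgram.maxCost + 64, fun n S hS L W hW => ?_⟩
  have hlength := hW.length_add_one hS.1
  obtain ⟨parent, k, u, h⟩ := hS.exists_isSpinePath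
  obtain ⟨t, s, hrun, ht, u', h', hpos⟩ :=
    RealRAM.runs_drawProgram (N := 2 * n) h hW (by omega) (by omega) L
  refine ⟨t, s, hrun, by linarith, ?_⟩
  rw [hpos]
  refine ⟨h'.isQuarterCircleLayout hS.1.connected, h'.layout.hasUnitResolution, fun G =>
    ⟨h'.layout.isCompatibleDrawing h'.layout_adj, (drawingArea_layout_le G h').trans ?_⟩⟩
  push_cast
  gcongr
  simp

theorem theorem2 :
    ∃ (P : RealRAM.Program) (C : ℕ),
      ∀ (n : ℕ) (G S : SimpleGraph (Fin n)), S ≤ G → IsCaterpillar S →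
        ∀ L W : List (Fin n × Fin n), IsEdgeList G L → IsEdgeList S W →
          ∃ (t : ℕ) (s : RealRAM.State),
            RealRAM.Run P (inputState n L W) t s ∧
            t ≤ C * (n + G.edgeSet.ncard) ∧
            IsCompatibleDrawing G S (outputDrawing n s) ∧
            IsQuarterCircleLayout S (outputDrawing n s) ∧
            HasUnitResolution (outputDrawing n s) ∧
            drawingArea G (outputDrawing n s) ≤ C * (n : ℝ) ^ 2 := by
  obtain ⟨P, C, h⟩ := theorem2_general
  refine ⟨P, C, fun n G S _ hS L W _ hW => ?_⟩
  obtain ⟨t, s, hrun, ht, hlayout, hres, hdraw⟩ := h n S hS L W hW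
  exact ⟨t, s, hrun, ht.trans (Nat.mul_le_mul_left C (Nat.le_add_right _ _)), (hdraw G).1,
    hlayout, hres, (hdraw G).2⟩
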